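/- Let $T \ge 2$ and suppose we are given a fast matrix multiplication algorithm that multiplies two $T \times T$ matrices with $r > T^2$ multiplications: $r$ products $M_1,\dots,M_r$, each the product of a nonempty $\{-1,1\}$-weighted sum of entries of $A$ and a nonempty $\{-1,1\}$-weighted sum of entries of $B$, such that every entry of $C = AB$ is a (fixed) $\{-1,1\}$-weighted sum of some of the $M_k$, identically in $A$ and $B$. Let $a_k$ and $b_k$ be the numbers of entries of $A$ and of $B$ that occur in $M_k$, and let $c_k$ be the number of entries of $C$ in whose expression $M_k$ occurs; let $s = \max\{\sum_k a_k, \sum_k b_k, \sum_k c_k\}$ be the sparsity of the algorithm, and put $\alpha = r/s$, $\beta = s/T^2$, $\gamma = \log_\beta(1/\alpha)$, $\omega = \log_T r$. A threshold circuit is an acyclic network of gates of unbounded fan-in; a gate with binary inputs $y_1,\dots,y_m$ outputs $1$ iff $\sum_i w_i y_i \ge t$, for integer constants $w_i, t$ belonging to the gate. Its size is the number of gates, and its depth is the length of a longest directed path from an input to the output gate. An integer matrix with $b$-bit entries is given to a circuit by writing each entry as $x^+ - x^-$, with $x^+, x^-$ nonnegative integers of at most $b$ bits, and presenting the bits of all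 $x^+, x^-$. Then $0 \le \gamma < 1$, and there is a constant $c > 0$ depending only on the algorithm such that the following holds. (1) For every constant $\kappa$ there are constants $K, m$, depending only on $\kappa$ and the algorithm, such that for every $N = T^l$ with $l \ge 1$, every integer $d \ge 1$, every bit length $b \le \kappa \log_2 N$ and every integer $\tau$, there is a threshold circuit of depth at most $2d+5$ with at most $$K (\log_2 N)^m \cdot d\, N^{\omega + c\gamma^d}$$ gates (that is, $\widetilde{O}(d N^{\omega + c\gamma^d})$ gates) which, for every $N \times N$ integer matrix $A$ with $b$-bit entries given as input, decides whether $\mathrm{trace}(A^3) \ge \tau$. (2) Consequently, for triangle counting: there are constants $K, m$ depending only on the algorithm such that for all $N = T^l$ with $l \ge 1$, all integers $d \ge 1$ and all integers $\tau$ there is a threshold circuit of depth at most $2d+5$ with at most $K(\log_2 N)^m \cdot d\,N^{\omega + c\gamma^d}$ gates which, given the adjacency matrix of a simple graph $G$ on $N$ vertices, decides whether $G$ has at least $\tau$ triangles. -/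

import Mathlib

/-- A threshold circuit with boolean inputs indexed by `ι` and one output gate. Gate `g` fires iff
the total weight of its firing predecessors (inputs and gates) is at least `threshold g`. Weights and
thresholds are integer constants; a nonzero weight is a wire, and the wiring between gates has no
directed cycle. -/
structure ThresholdCircuit (ι : Type) where
  Gate : Type
  gateFintype : Fintype Gate
  inputWeight : Gate → ι → ℤ
  gateWeight : Gate → Gate → ℤ
  threshold : Gate → ℤ
  output : Gate
  acyclic : WellFounded (fun h g : Gate => gateWeight g h ≠ 0)

namespace ThresholdCircuit

attribute [instance] ThresholdCircuit.gateFintype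

variable {ι : Type}

/-- The number of gates (input nodes are not gates). -/
def size (C : ThresholdCircuit ι) : ℕ := Fintype.card C.Gate

open Classical in
/-- The value computed by a gate on the input `x`; see `value_eq` for the recursion. -/
noncomputable def value [Fintype ι] (C : ThresholdCircuit ι) (x : ι → Bool) : C.Gate → Bool :=
  C.acyclic.fix fun g val =>
    decide (C.threshold g ≤
      (∑ i, if x i = true then C.inputWeight g i else 0) +
      ∑ h, if hw : C.gateWeight g h ≠ 0 then
        (if val h hw = true then C.gateWeight g h else 0) else 0)

theorem value_eq [Fintype ι] (C : ThresholdCircuit ι) (x : ι → Bool) (g : C.Gate) :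
    C.value x g = decide (C.threshold g ≤
      (∑ i, if x i = true then C.inputWeight g i else 0) +
      ∑ h, if C.value x h = true then C.gateWeight g h else 0) := by
  unfold value
  rw [WellFounded.fix_eq]
  congr 3
  refine Finset.sum_congr rfl fun h _ => ?_
  by_cases hw : C.gateWeight g h = 0
  · simp [hw]
  · simp [hw]

/-- The output of the circuit on the input `x`. -/
noncomputable def eval [Fintype ι] (C : ThresholdCircuit ι) (x : ι → Bool) : Bool :=
  C.value x C.output

open Classical in
/-- The depth of a gate: one more than the largest depth of a gate wired into it (one if there is
none), that is, the number of wires on a longest path from the input nodes to the gate, a gate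
without predecessors being counted as if it read an input. See `gateDepth_eq` for the recursion. -/
noncomputable def gateDepth (C : ThresholdCircuit ι) : C.Gate → ℕ :=
  C.acyclic.fix fun g dep =>
    1 + Finset.univ.sup fun h => if hw : C.gateWeight g h ≠ 0 then dep h hw else 0

theorem gateDepth_eq (C : ThresholdCircuit ι) (g : C.Gate) :
    C.gateDepth g =
      1 + Finset.univ.sup fun h => if C.gateWeight g h ≠ 0 then C.gateDepth h else 0 := by
  unfold gateDepth
  rw [WellFounded.fix_eq]
  congr 2

/-- The depth of the circuit: the length of a longest directed path from an input to the output. -/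
noncomputable def depth (C : ThresholdCircuit ι) : ℕ := C.gateDepth C.output

end ThresholdCircuit

/-- A fast matrix multiplication algorithm for `T × T` matrices with `r` multiplications
`M k = (∑ p q, u k p q * A p q) * (∑ p q, v k p q * B p q)` and `(A * B) i j = ∑ k, w k i j * M k`,
all weights being `-1`, `0` (the term does not appear) or `1`. Every `M k` is a product of two
expressions in which at least one block appears. Both sides of `correct` are bilinear in `(A, B)`, so
correctness over `ℤ` is the identity of coefficients, which gives correctness over every ring, and in
particular for blocks. -/
structure FastMatMul (T r : ℕ) where
  u : Fin r → Matrix (Fin T) (Fin T) ℤ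
  v : Fin r → Matrix (Fin T) (Fin T) ℤ
  w : Fin r → Matrix (Fin T) (Fin T) ℤ
  u_weight : ∀ k p q, u k p q = -1 ∨ u k p q = 0 ∨ u k p q = 1
  v_weight : ∀ k p q, v k p q = -1 ∨ v k p q = 0 ∨ v k p q = 1
  w_weight : ∀ k p q, w k p q = -1 ∨ w k p q = 0 ∨ w k p q = 1
  u_nonempty : ∀ k, ∃ p q, u k p q ≠ 0
  v_nonempty : ∀ k, ∃ p q, v k p q ≠ 0
  correct : ∀ (A B : Matrix (Fin T) (Fin T) ℤ) (i j : Fin T),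
    (A * B) i j =
      ∑ k, w k i j * ((∑ p, ∑ q, u k p q * A p q) * (∑ p, ∑ q, v k p q * B p q))

namespace FastMatMul

variable {T r : ℕ}

/-- The total number of nonzero weights in a family of expressions. -/
def numTerms (u : Fin r → Matrix (Fin T) (Fin T) ℤ) : ℕ :=
  ∑ k, (Finset.univ.filter fun pq : Fin T × Fin T => u k pq.1 pq.2 ≠ 0).card

/-- The sparsity `s = max {s_A, s_B, s_C}`. -/
def sparsity (F : FastMatMul T r) : ℕ :=
  max (numTerms F.u) (max (numTerms F.v) (numTerms F.w))

/-- `α = r / s`. -/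
noncomputable def alpha (F : FastMatMul T r) : ℝ := (r : ℝ) / (F.sparsity : ℝ)

/-- `β = s / T ^ 2`. -/
noncomputable def beta (F : FastMatMul T r) : ℝ := (F.sparsity : ℝ) / (T : ℝ) ^ 2

/-- `γ = log_β (1 / α)`. -/
noncomputable def gamma (F : FastMatMul T r) : ℝ := Real.logb F.beta (1 / F.alpha)

/-- `ω = log_T r`. -/
noncomputable def omega (_F : FastMatMul T r) : ℝ := Real.logb (T : ℝ) (r : ℝ)

end FastMatMul

/-- The input nodes of a circuit reading an `N × N` integer matrix: for each entry, `b` bits of a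
nonnegative part (`true`) and `b` bits of a nonpositive part (`false`). -/
abbrev MatrixBits (N b : ℕ) : Type := Fin N × Fin N × Bool × Fin b

/-- The matrix with entries `x⁺ - x⁻`, where `x⁺`, `x⁻` are the numbers with the given binary digits
(bit `k` has weight `2 ^ k`). -/
def decodeMatrix {N b : ℕ} (x : MatrixBits N b → Bool) : Matrix (Fin N) (Fin N) ℤ :=
  Matrix.of fun i j =>
    (∑ k : Fin b, if x (i, j, true, k) = true then (2 : ℤ) ^ (k : ℕ) else 0) -
    (∑ k : Fin b, if x (i, j, false, k) = true then (2 : ℤ) ^ (k : ℕ) else 0)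

/-! The `l`-fold tensor power of the algorithm writes the trace of `A ^ 3` as a sum over `r ^ l`
indices of products of three linear forms in the entries of `A` (`FastMatMul.trace_pow_three`), so
no matrix product has to be computed, only the values of these forms.

The coefficients of a form are products over `l` positions, hence the positions can be resolved in
batches: blocks with the first `h'` positions resolved are sparse combinations of blocks with the
first `h` resolved (`RealizesBlocks.step`). The binary digits of such combinations are found in
depth two, with a number of gates governed by the total weight of the coefficients, the number of
outputs and the number of digits (`Realizes.testBit_sum`). With one layer copying inputs, `d`
batches, and two layers for the sum of triple products (`Realizes.le_sum_mul_mul`), the depth is `2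
* d + 3`.

Up to a factor linear in the number of digits, a batch costs `r ^ h * s ^ (h' - h) * T ^ (2 * (l -
h'))`, which is `r ^ l` times `β` to the power `h' - γ * h - (1 - γ) * l`
(`FastMatMul.level_cost_eq`). For `h_i = (1 - γ ^ i) * l` this exponent vanishes, except in the last
batch, which has to end at `l` and is left with `γ ^ d * l`. Since `N = T ^ l`, the excess is `N ^
(c * γ ^ d)` with `c = log_T β`. Triangles reduce to traces because the trace of the cubed adjacency
matrix is six times their number. -/

/-! ### Networks of threshold gates and their composition -/

/-- A feed-forward network of threshold gates together with a rank function witnessing acyclicity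
and the values of its gates. -/
structure RankedNetwork (ι : Type) [Fintype ι] where
  Gate : Type
  gateFintype : Fintype Gate
  inputWeight : Gate → ι → ℤ
  gateWeight : Gate → Gate → ℤ
  threshold : Gate → ℤ
  rank : Gate → ℕ
  value : Gate → (ι → Bool) → Bool
  rank_lt : ∀ g h, gateWeight g h ≠ 0 → rank h < rank g
  value_eq : ∀ g x, value g x = decide (threshold g ≤
    (∑ i, if x i = true then inputWeight g i else 0) +
      ∑ h, if value h x = true then gateWeight g h else 0)

namespace RankedNetwork

attribute [instance] RankedNetwork.gateFintype

variable {ι : Type} [Fintype ι]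

/-- The threshold circuit of a ranked network with a chosen output gate. -/
abbrev toCircuit (R : RankedNetwork ι) (o : R.Gate) : ThresholdCircuit ι where
  Gate := R.Gate
  gateFintype := R.gateFintype
  inputWeight := R.inputWeight
  gateWeight := R.gateWeight
  threshold := R.threshold
  output := o
  acyclic := Subrelation.wf (fun {h g} hw => R.rank_lt g h hw) (measure R.rank).wf

theorem toCircuit_value (R : RankedNetwork ι) (o : R.Gate) (x : ι → Bool) (g : R.Gate) :
    (R.toCircuit o).value x g = R.value g x := by
  induction hn : R.rank g using Nat.strong_induction_on generalizing g with
  | _ n ih =>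
    subst hn
    refine ((R.toCircuit o).value_eq x g).trans (Eq.trans ?_ (R.value_eq g x).symm)
    have : ∀ h : R.Gate, (if (R.toCircuit o).value x h = true then R.gateWeight g h else 0)
        = if R.value h x = true then R.gateWeight g h else 0 := by
      intro h
      by_cases hw : R.gateWeight g h = 0
      · simp only [hw, ite_self]
      · rw [ih _ (R.rank_lt g h hw) h rfl]
    exact congrArg (fun z : ℤ => decide (R.threshold g ≤
      (∑ i, if x i = true then R.inputWeight g i else 0) + z))
      (Finset.sum_congr rfl fun h _ => this h)

theorem toCircuit_gateDepth_le (R : RankedNetwork ι) (o g : R.Gate) :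
    (R.toCircuit o).gateDepth g ≤ R.rank g + 1 := by
  induction hn : R.rank g using Nat.strong_induction_on generalizing g with
  | _ n ih =>
    subst hn
    refine ((R.toCircuit o).gateDepth_eq g).trans_le ?_
    rw [add_comm]
    refine Nat.add_le_add_right (Finset.sup_le fun (h : R.Gate) _ => ?_) 1
    split_ifs with hw
    · exact (ih _ (R.rank_lt g h hw) h rfl).trans (R.rank_lt g h hw)
    · exact Nat.zero_le _

end RankedNetwork

/-- The Boolean functions `f j` are computed by gates of a common network with at most `s` gates and
of depth at most `D`. -/
def Realizes {ι : Type} [Fintype ι] (D s : ℕ) {σ : Type} (f : σ → (ι → Bool) → Bool) : Prop :=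
  ∃ (R : RankedNetwork ι) (src : σ → R.Gate),
    (∀ g, R.rank g < D) ∧ Fintype.card R.Gate ≤ s ∧ ∀ j x, R.value (src j) x = f j x

section

variable {α β X : Type} [Fintype α] [Fintype β] (v : α → X → Bool) (v' : β → X → Bool) (x : X)

theorem sum_ite_sumElim_zero_right (a : α → ℤ) :
    (∑ h : α ⊕ β, if Sum.elim v v' h x = true then Sum.elim a (fun _ => 0) h else 0)
      = ∑ h, if v h x = true then a h else 0 :=
  (Fintype.sum_sum_type _).trans <| (congrArg (_ + ·)
    (Finset.sum_eq_zero fun _ _ => ite_self _)).trans (add_zero _)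

theorem sum_ite_sumElim_zero_left (b : β → ℤ) :
    (∑ h : α ⊕ β, if Sum.elim v v' h x = true then Sum.elim (fun _ => 0) b h else 0)
      = ∑ h, if v' h x = true then b h else 0 :=
  (Fintype.sum_sum_type _).trans <| (congrArg (· + _)
    (Finset.sum_eq_zero fun _ _ => ite_self _)).trans (zero_add _)

end

namespace Realizes

variable {ι : Type} [Fintype ι] {σ σ' : Type}

theorem exists_circuit {D s : ℕ} {f : σ → (ι → Bool) → Bool} (hf : Realizes D s f) (j : σ) :
    ∃ C : ThresholdCircuit ι, C.depth ≤ D ∧ C.size ≤ s ∧ ∀ x, C.eval x = f j x := by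
  obtain ⟨R, src, hD, hs, hv⟩ := hf
  refine ⟨R.toCircuit (src j), ?_, hs, fun x => ?_⟩
  · exact (R.toCircuit_gateDepth_le _ _).trans (hD _)
  · exact (R.toCircuit_value _ _ _).trans (hv j x)

theorem comp {D s : ℕ} {f : σ → (ι → Bool) → Bool} (hf : Realizes D s f) (e : σ' → σ) :
    Realizes D s fun j => f (e j) := by
  obtain ⟨R, src, hD, hs, hv⟩ := hf
  exact ⟨R, fun j => src (e j), hD, hs, fun j x => hv (e j) x⟩

theorem mono {D s s' : ℕ} {f : σ → (ι → Bool) → Bool} (hf : Realizes D s f) (h : s ≤ s') :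
    Realizes D s' f := by
  obtain ⟨R, src, hD, hs, hv⟩ := hf
  exact ⟨R, src, hD, hs.trans h, hv⟩

theorem of_inputs [Fintype σ] {f : σ → (ι → Bool) → Bool} (w : σ → ι → ℤ) (t : σ → ℤ)
    (hf : ∀ j x, f j x = decide (t j ≤ ∑ i, if x i = true then w j i else 0)) :
    Realizes 1 (Fintype.card σ) f :=
  ⟨{ Gate := σ
     gateFintype := inferInstance
     inputWeight := w
     gateWeight := fun _ _ => 0
     threshold := t
     rank := fun _ => 0
     value := f
     rank_lt := fun _ _ h => absurd rfl h
     value_eq := fun g x => by simp [hf] }, id, fun _ => Nat.one_pos, le_rfl, fun _ _ => rfl⟩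

/-- Adding one layer of threshold gates. -/
theorem layer [Fintype σ] [Fintype σ'] {D s : ℕ} {f : σ → (ι → Bool) → Bool}
    (hf : Realizes D s f) {g : σ' → (ι → Bool) → Bool} (w : σ' → σ → ℤ) (t : σ' → ℤ)
    (hg : ∀ j x, g j x = decide (t j ≤ ∑ i, if f i x = true then w j i else 0)) :
    Realizes (D + 1) (s + Fintype.card σ') g := by
  classical
  obtain ⟨R, src, hD, hs, hv⟩ := hf
  refine ⟨{ Gate := R.Gate ⊕ σ'
            gateFintype := inferInstance
            inputWeight := Sum.elim R.inputWeight fun _ _ => 0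
            gateWeight := Sum.elim (fun a => Sum.elim (R.gateWeight a) fun _ => 0)
              -- Several functions `f i` may be read off the same gate, so the weights of all `i`
              -- with `src i = h` are added up on one wire.
              (fun j => Sum.elim (fun h => ∑ i, if src i = h then w j i else 0) fun _ => 0)
            threshold := Sum.elim R.threshold t
            rank := Sum.elim R.rank fun _ => D
            value := Sum.elim R.value g
            rank_lt := ?_
            value_eq := ?_ }, Sum.inr, ?_, ?_, fun _ _ => rfl⟩
  · rintro (a | j) (h | j') hne
    · exact R.rank_lt a h hne
    · exact absurd rfl hne
    · exact hD h
    · exact absurd rfl hne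
  · rintro (a | j) x
    · exact (R.value_eq a x).trans (congrArg (fun z : ℤ => decide (R.threshold a ≤
        (∑ i, if x i = true then R.inputWeight a i else 0) + z))
        (sum_ite_sumElim_zero_right R.value g x (R.gateWeight a)).symm)
    · have key : (∑ h, if R.value h x = true then ∑ i, (if src i = h then w j i else 0) else 0)
          = ∑ i, if f i x = true then w j i else 0 := by
        have : ∀ h, (if R.value h x = true then ∑ i, (if src i = h then w j i else 0) else 0)
            = ∑ i, if src i = h then (if R.value h x = true then w j i else 0) else 0 := by
          intro h
          by_cases hh : R.value h x = true <;> simp [hh]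
        simp_rw [this]
        rw [Finset.sum_comm]
        refine Finset.sum_congr rfl fun i _ => ?_
        simp [hv]
      have h0 : (∑ i : ι, if x i = true then (0 : ℤ) else 0) = 0 := by simp
      refine (hg j x).trans (congrArg (fun z : ℤ => decide (t j ≤ z)) ?_)
      exact key.symm.trans ((zero_add _).symm.trans (congrArg₂ (· + ·) h0.symm
        (sum_ite_sumElim_zero_right R.value g x _).symm))
  · rintro (a | j)
    · exact (hD a).trans (Nat.lt_succ_self D)
    · exact Nat.lt_succ_self D
  · rw [Fintype.card_sum]
    exact Nat.add_le_add_right hs _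

/-- Two networks side by side. -/
theorem sum {D s s' : ℕ} {f : σ → (ι → Bool) → Bool} {f' : σ' → (ι → Bool) → Bool}
    (hf : Realizes D s f) (hf' : Realizes D s' f') : Realizes D (s + s') (Sum.elim f f') := by
  obtain ⟨R, src, hD, hs, hv⟩ := hf
  obtain ⟨R', src', hD', hs', hv'⟩ := hf'
  refine ⟨{ Gate := R.Gate ⊕ R'.Gate
            gateFintype := inferInstance
            inputWeight := Sum.elim R.inputWeight R'.inputWeight
            gateWeight := Sum.elim (fun a => Sum.elim (R.gateWeight a) fun _ => 0)
              (fun a => Sum.elim (fun _ => 0) (R'.gateWeight a))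
            threshold := Sum.elim R.threshold R'.threshold
            rank := Sum.elim R.rank R'.rank
            value := Sum.elim R.value R'.value
            rank_lt := ?_
            value_eq := ?_ }, Sum.map src src', ?_, ?_, ?_⟩
  · rintro (a | a) (h | h) hne
    · exact R.rank_lt a h hne
    · exact absurd rfl hne
    · exact absurd rfl hne
    · exact R'.rank_lt a h hne
  · rintro (a | a) x
    · exact (R.value_eq a x).trans (congrArg (fun z : ℤ => decide (R.threshold a ≤
        (∑ i, if x i = true then R.inputWeight a i else 0) + z))
        (sum_ite_sumElim_zero_right R.value R'.value x (R.gateWeight a)).symm)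
    · exact (R'.value_eq a x).trans (congrArg (fun z : ℤ => decide (R'.threshold a ≤
        (∑ i, if x i = true then R'.inputWeight a i else 0) + z))
        (sum_ite_sumElim_zero_left R.value R'.value x (R'.gateWeight a)).symm)
  · rintro (a | a)
    exacts [hD a, hD' a]
  · rw [Fintype.card_sum]
    exact Nat.add_le_add hs hs'
  · rintro (j | j) x
    exacts [hv j x, hv' j x]

end Realizes

/-! ### Binary digits of sums in depth two -/

theorem sum_testBit_two_pow {W n : ℕ} (k : Fin W) :
    (∑ k' : Fin W, if k' ≤ k then (if n.testBit k' = true then 2 ^ (k' : ℕ) else 0) else 0)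
      = n % 2 ^ ((k : ℕ) + 1) := by
  have key : ∀ m : ℕ, n % 2 ^ m = ∑ i ∈ Finset.range m, if n.testBit i = true then 2 ^ i else 0 := by
    intro m
    induction m with
    | zero => simp [Nat.mod_one]
    | succ m ih =>
      rw [Finset.sum_range_succ, ← ih, Nat.mod_pow_succ, Nat.testBit_eq_decide_div_mod_eq]
      rcases Nat.mod_two_eq_zero_or_one (n / 2 ^ m) with h | h <;> simp [h]
  rw [key, ← Finset.sum_filter]
  symm
  refine Finset.sum_bij' (fun i hi => (⟨i, by have := k.2; have := Finset.mem_range.1 hi; omega⟩ : Fin W))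
    (fun k' _ => (k' : ℕ)) ?_ ?_ ?_ ?_ ?_
  · intro i hi
    simp only [Finset.mem_filter, Finset.mem_univ, true_and, Fin.le_def]
    have := Finset.mem_range.1 hi
    omega
  · intro k' hk'
    simp only [Finset.mem_filter, Finset.mem_univ, true_and, Fin.le_def] at hk'
    exact Finset.mem_range.2 (by omega)
  all_goals simp

theorem sum_testBit_of_lt {W n : ℕ} (hn : n < 2 ^ W) :
    (∑ k : Fin W, if n.testBit k = true then 2 ^ (k : ℕ) else 0) = n := by
  cases W with
  | zero => simp at hn; simp [hn]
  | succ W =>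
    have := sum_testBit_two_pow (n := n) (Fin.last W)
    simp only [Fin.le_last, if_true, Fin.val_last, Nat.mod_eq_of_lt hn] at this
    exact this

/-- Digit `k` is the parity of `S / 2 ^ k`. The tests that succeed are exactly those with `m < S / 2
^ k`, so their alternating sum is `1` or `0` according to this parity; `hS` provides enough tests.
-/
theorem testBit_eq_decide_alternating_sum {S k n : ℕ} (hS : S / 2 ^ k ≤ n) :
    S.testBit k = decide ((1 : ℤ) ≤ ∑ m : Fin n,
      if decide (((m : ℤ) + 1) * 2 ^ k ≤ S) = true then (-1 : ℤ) ^ (m : ℕ) else 0) := by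
  have h1 : ∀ m : ℕ, (((m : ℤ) + 1) * 2 ^ k ≤ S) ↔ m < S / 2 ^ k := by
    intro m
    rw [← Nat.succ_le_iff, Nat.le_div_iff_mul_le (by positivity)]
    exact_mod_cast Iff.rfl
  simp only [decide_eq_true_eq, h1]
  rw [Fin.sum_univ_eq_sum_range (fun m => if m < S / 2 ^ k then (-1 : ℤ) ^ m else 0),
    ← Finset.sum_filter]
  have : (Finset.range n).filter (fun m => m < S / 2 ^ k) = Finset.range (S / 2 ^ k) := by
    ext m
    simp only [Finset.mem_filter, Finset.mem_range]
    omega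
  rw [this, neg_one_geom_sum, Nat.testBit_eq_decide_div_mod_eq]
  by_cases h : S / 2 ^ k % 2 = 1
  · simp [h, Nat.even_iff]
  · have : S / 2 ^ k % 2 = 0 := by omega
    simp [this, Nat.even_iff]

namespace Realizes

/-- The binary digits of linear combinations with coefficients in `ℕ`, from the binary digits of the
terms, in depth two. -/
theorem testBit_sum {ι : Type} [Fintype ι] {I J : Type} [Fintype I] [Fintype J] {D s W : ℕ}
    {X : I → (ι → Bool) → ℕ} (hX : Realizes D s fun (p : I × Fin W) x => (X p.1 x).testBit p.2)
    (c : J → I → ℕ) :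
    Realizes (D + 1 + 1) (s + W * ∑ j, (2 * ∑ i, c j i + 1)) fun (p : J × Fin W) x =>
      (∑ i, c p.1 i * X i x).testBit p.2 := by
  classical
  -- Digit `k` of the sum depends only on the terms modulo `2 ^ (k + 1)`. Truncating them keeps the
  -- quotient by `2 ^ k` at most `2 * ∑ i, c j i`, so the number of tests per digit does not grow
  -- with the size of the terms.
  have h1 := hX.layer (σ' := (j : J) × (Fin W × Fin (2 * ∑ i, c j i)))
    (g := fun q x => decide (((q.2.2 : ℤ) + 1) * 2 ^ (q.2.1 : ℕ) ≤
      ((∑ i, c q.1 i * (X i x % 2 ^ ((q.2.1 : ℕ) + 1)) : ℕ) : ℤ)))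
    (fun q p => if p.2 ≤ q.2.1 then (c q.1 p.1 : ℤ) * 2 ^ (p.2 : ℕ) else 0)
    (fun q => ((q.2.2 : ℤ) + 1) * 2 ^ (q.2.1 : ℕ)) ?_
  swap
  · rintro ⟨j, k, m⟩ x
    congr 2
    rw [Fintype.sum_prod_type]
    push_cast
    refine Finset.sum_congr rfl fun i _ => ?_
    have := congrArg (Nat.cast (R := ℤ)) (sum_testBit_two_pow (n := X i x) k)
    push_cast at this
    rw [← this, Finset.mul_sum]
    refine Finset.sum_congr rfl fun k' _ => ?_
    split_ifs <;> simp
  have h2 := h1.layer (σ' := J × Fin W)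
    (g := fun p x => (∑ i, c p.1 i * X i x).testBit p.2)
    (fun p q => if (⟨p.1, p.2⟩ : J × Fin W) = (q.1, q.2.1) then (-1 : ℤ) ^ (q.2.2 : ℕ) else 0)
    (fun _ => 1) ?_
  · convert h2 using 1
    simp only [Fintype.card_sigma, Fintype.card_prod, Fintype.card_fin, Finset.sum_add_distrib,
      ← Finset.mul_sum, Finset.sum_const, Finset.card_univ, smul_eq_mul, mul_one]
    ring
  · rintro ⟨j, k⟩ x
    have hdiv : (∑ i, c j i * (X i x % 2 ^ ((k : ℕ) + 1))) / 2 ^ (k : ℕ) ≤ 2 * ∑ i, c j i := by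
      refine Nat.div_le_of_le_mul ?_
      calc ∑ i, c j i * (X i x % 2 ^ ((k : ℕ) + 1)) ≤ ∑ i, c j i * 2 ^ ((k : ℕ) + 1) :=
            Finset.sum_le_sum fun i _ =>
              Nat.mul_le_mul_left _ (Nat.mod_lt _ (by positivity)).le
        _ = 2 ^ (k : ℕ) * (2 * ∑ i, c j i) := by rw [← Finset.sum_mul]; ring
    have hbit : (∑ i, c j i * X i x).testBit k
        = (∑ i, c j i * (X i x % 2 ^ ((k : ℕ) + 1))).testBit k := by
      have hm : (∑ i, c j i * X i x) % 2 ^ ((k : ℕ) + 1)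
          = (∑ i, c j i * (X i x % 2 ^ ((k : ℕ) + 1))) % 2 ^ ((k : ℕ) + 1) := by
        rw [Finset.sum_nat_mod, Finset.sum_nat_mod (f := fun i => c j i * (X i x % _))]
        simp [Nat.mul_mod]
      have h3 := Nat.testBit_mod_two_pow (∑ i, c j i * X i x) ((k : ℕ) + 1) k
      have h4 := Nat.testBit_mod_two_pow (∑ i, c j i * (X i x % 2 ^ ((k : ℕ) + 1))) ((k : ℕ) + 1) k
      rw [hm, h4] at h3
      simpa using h3.symm
    rw [hbit, testBit_eq_decide_alternating_sum hdiv]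
    congr 2
    rw [Fintype.sum_sigma, Finset.sum_eq_single j, Fintype.sum_prod_type, Finset.sum_eq_single k]
    · simp
    · intro k' _ hk
      simp [Ne.symm hk]
    · simp
    · intro j' _ hj
      simp [Ne.symm hj]
    · simp

end Realizes

/-! ### Blocks with partially resolved positions -/

/-- The labels of one position of a block index: an unresolved position carries a row and a column
index, a resolved one the index of a product. -/
def Slot (T r : ℕ) : Bool → Type
  | true => Fin r
  | false => Fin T × Fin T

namespace Slot

variable {T r : ℕ}

instance instFintype : ∀ b, Fintype (Slot T r b)
  | true => inferInstanceAs (Fintype (Fin r))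
  | false => inferInstanceAs (Fintype (Fin T × Fin T))

/-- The coefficients that pass from the labels `b` to the labels `b'` of a position. -/
def coeff (u : Fin r → Matrix (Fin T) (Fin T) ℤ) : ∀ b' b, Slot T r b' → Slot T r b → ℤ
  | true, true => fun (k k' : Fin r) => if k = k' then 1 else 0
  | true, false => fun (k : Fin r) (p : Fin T × Fin T) => u k p.1 p.2
  -- A default value: a resolved position never becomes unresolved, and the lemmas below assume `b ≤
  -- b'`.
  | false, true => fun _ _ => 0
  | false, false => fun (p p' : Fin T × Fin T) => if p = p' then 1 else 0

section

variable {α : Type} [Fintype α] [DecidableEq α]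

theorem sum_delta_mul (j : α) (f : α → ℤ) : ∑ i, (if j = i then (1 : ℤ) else 0) * f i = f j := by
  simp

theorem sum_mul_delta (j : α) (f : α → ℤ) : ∑ i, f i * (if i = j then (1 : ℤ) else 0) = f j := by
  simp

theorem sum_natAbs_delta (j : α) : ∑ i, (if j = i then (1 : ℤ) else 0).natAbs = 1 := by
  simp [apply_ite Int.natAbs]

end

variable (u : Fin r → Matrix (Fin T) (Fin T) ℤ)

/-- A position is resolved only once, so at least one of the two factors is a Kronecker delta. This
is what allows the resolution to be done in stages. -/
theorem sum_coeff_mul_coeff {b b' : Bool} (h : b ≤ b') (j : Slot T r b') (z : Slot T r false) :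
    ∑ i, coeff u b' b j i * coeff u b false i z = coeff u b' false j z := by
  cases b <;> cases b'
  · exact sum_delta_mul (α := Fin T × Fin T) j _
  · exact sum_mul_delta (α := Fin T × Fin T) z fun p => u j p.1 p.2
  · exact absurd h (by decide)
  · exact sum_delta_mul (α := Fin r) j _

/-- Controls the growth of the numbers: a newly resolved position combines at most `T ^ 2` terms of
weight at most one, and any other position contributes a delta. -/
theorem mul_sum_natAbs_coeff_le {b b' : Bool} (h : b ≤ b')
    (hu : ∀ k p q, (u k p q).natAbs ≤ 1) (j : Slot T r b') :
    (∑ i, (coeff u b' b j i).natAbs) * (if b = true then T ^ 2 else 1)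
      ≤ if b' = true then T ^ 2 else 1 := by
  cases b <;> cases b'
  · refine le_of_eq ?_
    simp only [Bool.false_eq_true, if_false, mul_one]
    exact sum_natAbs_delta (α := Fin T × Fin T) j
  · simp only [Bool.false_eq_true, if_false, mul_one, if_true]
    refine (Finset.sum_le_card_nsmul (Finset.univ : Finset (Fin T × Fin T)) _ 1
      fun i _ => hu _ _ _).trans ?_
    simp [sq]
  · exact absurd h (by decide)
  · simp only [if_true]
    refine le_of_eq ?_
    conv_rhs => rw [← one_mul (T ^ 2)]
    congr 1
    exact sum_natAbs_delta (α := Fin r) j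

theorem card_eq (b : Bool) : Fintype.card (Slot T r b) = if b = true then r else T ^ 2 := by
  cases b
  · exact (Fintype.card_prod (Fin T) (Fin T)).trans (by simp [sq])
  · exact Fintype.card_fin r

/-- The contribution of one position to the total weight of a stage. Sparsity enters the gate count
here, at the newly resolved positions. -/
theorem sum_sum_natAbs_coeff {b b' : Bool} (h : b ≤ b')
    (hu : ∀ k p q, (u k p q).natAbs ≤ 1) :
    ∑ j, ∑ i, (coeff u b' b j i).natAbs
      = if b = true then r else if b' = true then FastMatMul.numTerms u else T ^ 2 := by
  have h1 : ∀ k p q, (u k p q).natAbs = if u k p q ≠ 0 then 1 else 0 := by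
    intro k p q
    have := hu k p q
    split_ifs with h
    · exact le_antisymm this (Int.natAbs_pos.2 h)
    · simpa using h
  have hdelta : ∀ {α : Type} [Fintype α] [DecidableEq α],
      ∑ j : α, ∑ i : α, (if j = i then (1 : ℤ) else 0).natAbs = Fintype.card α := by
    intro α _ _
    simp only [sum_natAbs_delta, Finset.sum_const, Finset.card_univ, smul_eq_mul, mul_one]
  cases b <;> cases b'
  · exact (hdelta (α := Fin T × Fin T)).trans (by simp [sq])
  · simp only [Bool.false_eq_true, if_false, if_true]
    refine Finset.sum_congr rfl fun k _ => ?_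
    rw [Finset.card_filter]
    exact Finset.sum_congr rfl fun p _ => h1 k p.1 p.2
  · exact absurd h (by decide)
  · exact (hdelta (α := Fin r)).trans (by simp)

end Slot

/-- Block indices whose resolved positions are those `t` with `b t = true`. -/
abbrev BlockIndex (T r : ℕ) {l : ℕ} (b : Fin l → Bool) : Type := ∀ t, Slot T r (b t)

namespace BlockIndex

variable {T r l : ℕ} (u : Fin r → Matrix (Fin T) (Fin T) ℤ)

/-- The coefficient of one block in another. -/
def coeff (b' b : Fin l → Bool) (j : BlockIndex T r b') (i : BlockIndex T r b) : ℤ :=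
  ∏ t, Slot.coeff u (b' t) (b t) (j t) (i t)

theorem natAbs_coeff (b' b : Fin l → Bool) (j : BlockIndex T r b') (i : BlockIndex T r b) :
    (coeff u b' b j i).natAbs = ∏ t, (Slot.coeff u (b' t) (b t) (j t) (i t)).natAbs :=
  map_prod Int.natAbsHom _ _

/-- Coefficients are products over positions, so a sum over block indices factors into sums over
single slots; the next lemmas rest on the same factorization. -/
theorem sum_coeff_mul_coeff {b b' : Fin l → Bool} (h : b ≤ b') (j : BlockIndex T r b')
    (z : BlockIndex T r fun _ : Fin l => false) :
    ∑ i, coeff u b' b j i * coeff u b (fun _ => false) i z = coeff u b' (fun _ => false) j z := by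
  simp only [coeff, ← Finset.prod_mul_distrib]
  rw [← Fintype.prod_sum fun t i => Slot.coeff u (b' t) (b t) (j t) i *
    Slot.coeff u (b t) false i (z t)]
  exact Finset.prod_congr rfl fun t _ => Slot.sum_coeff_mul_coeff u (h t) _ _

theorem mul_sum_natAbs_coeff_le {b b' : Fin l → Bool} (h : b ≤ b')
    (hu : ∀ k p q, (u k p q).natAbs ≤ 1) (j : BlockIndex T r b') :
    (∑ i, (coeff u b' b j i).natAbs) * (∏ t, if b t = true then T ^ 2 else 1)
      ≤ ∏ t, if b' t = true then T ^ 2 else 1 := by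
  simp only [natAbs_coeff]
  rw [← Fintype.prod_sum fun t i => (Slot.coeff u (b' t) (b t) (j t) i).natAbs,
    ← Finset.prod_mul_distrib]
  exact Finset.prod_le_prod' fun t _ => Slot.mul_sum_natAbs_coeff_le u (h t) hu _

theorem card_eq (b : Fin l → Bool) :
    Fintype.card (BlockIndex T r b) = ∏ t, if b t = true then r else T ^ 2 := by
  rw [Fintype.card_pi]
  exact Finset.prod_congr rfl fun t _ => Slot.card_eq _

theorem sum_sum_natAbs_coeff {b b' : Fin l → Bool} (h : b ≤ b')
    (hu : ∀ k p q, (u k p q).natAbs ≤ 1) :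
    ∑ j, ∑ i, (coeff u b' b j i).natAbs
      = ∏ t, if b t = true then r else if b' t = true then FastMatMul.numTerms u else T ^ 2 := by
  simp only [natAbs_coeff]
  have : ∀ j : BlockIndex T r b', ∑ i : BlockIndex T r b,
      ∏ t, (Slot.coeff u (b' t) (b t) (j t) (i t)).natAbs
      = ∏ t, ∑ i, (Slot.coeff u (b' t) (b t) (j t) i).natAbs := fun j =>
    (Fintype.prod_sum fun t i => (Slot.coeff u (b' t) (b t) (j t) i).natAbs).symm
  simp only [this]
  rw [← Fintype.prod_sum fun t j => ∑ i, (Slot.coeff u (b' t) (b t) j i).natAbs]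
  exact Finset.prod_congr rfl fun t _ => Slot.sum_sum_natAbs_coeff u (h t) hu

end BlockIndex

/-- The binary digits of the nonnegative and nonpositive parts of all blocks of kind `b` are computed
in depth `D` with `s` gates from the entries `a`, for an input matrix with parts bounded by `M`. -/
def RealizesBlocks {T r l : ℕ} {ι : Type} [Fintype ι] (u : Fin r → Matrix (Fin T) (Fin T) ℤ)
    (W M : ℕ) (a : BlockIndex T r (fun _ : Fin l => false) → (ι → Bool) → ℤ) (b : Fin l → Bool)
    (D s : ℕ) : Prop :=
  ∃ X : BlockIndex T r b → Bool → (ι → Bool) → ℕ,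
    (∀ j σ x, X j σ x ≤ M * ∏ t, if b t = true then T ^ 2 else 1) ∧
    (∀ j x, (X j true x : ℤ) - X j false x
      = ∑ z, BlockIndex.coeff u b (fun _ => false) j z * a z x) ∧
    Realizes D s fun (p : (BlockIndex T r b × Bool) × Fin W) x => (X p.1.1 p.1.2 x).testBit p.2

theorem RealizesBlocks.step {T r l : ℕ} {ι : Type} [Fintype ι]
    {u : Fin r → Matrix (Fin T) (Fin T) ℤ} (hu : ∀ k p q, (u k p q).natAbs ≤ 1)
    {W M : ℕ} {a : BlockIndex T r (fun _ : Fin l => false) → (ι → Bool) → ℤ}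
    {b b' : Fin l → Bool} (hb : b ≤ b') {D s : ℕ} (h : RealizesBlocks u W M a b D s) :
    RealizesBlocks u W M a b' (D + 2) (s + 2 * W *
      (2 * (∏ t, if b t = true then r else if b' t = true then FastMatMul.numTerms u else T ^ 2)
        + ∏ t, if b' t = true then r else T ^ 2)) := by
  obtain ⟨X, hM, hX, hR⟩ := h
  -- Positive coefficients keep the parts of a difference and negative ones exchange them, so both
  -- parts of a new block are combinations with coefficients in `ℕ`.
  let c : BlockIndex T r b' × Bool → BlockIndex T r b × Bool → ℕ := fun j i =>
    if j.2 = i.2 then (BlockIndex.coeff u b' b j.1 i.1).toNat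
    else (-BlockIndex.coeff u b' b j.1 i.1).toNat
  have hc : ∀ j, ∑ i, c j i = ∑ i, (BlockIndex.coeff u b' b j.1 i).natAbs := by
    rintro ⟨j, σ⟩
    rw [Fintype.sum_prod_type]
    refine Finset.sum_congr rfl fun i _ => ?_
    rw [Fintype.sum_bool]
    cases σ <;> simp [c] <;> omega
  refine ⟨fun j σ x => ∑ i, c (j, σ) i * X i.1 i.2 x, ?_, ?_, ?_⟩
  · intro j σ x
    calc ∑ i, c (j, σ) i * X i.1 i.2 x
        ≤ ∑ i, c (j, σ) i * (M * ∏ t, if b t = true then T ^ 2 else 1) :=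
          Finset.sum_le_sum fun i _ => Nat.mul_le_mul_left _ (hM _ _ _)
      _ = M * ((∑ i, (BlockIndex.coeff u b' b j i).natAbs) *
            ∏ t, if b t = true then T ^ 2 else 1) := by
          rw [← Finset.sum_mul, hc]; ring
      _ ≤ _ := Nat.mul_le_mul_left _ (BlockIndex.mul_sum_natAbs_coeff_le u hb hu j)
  · intro j x
    have h1 : ((∑ i, c (j, true) i * X i.1 i.2 x : ℕ) : ℤ) - (∑ i, c (j, false) i * X i.1 i.2 x : ℕ)
        = ∑ i, BlockIndex.coeff u b' b j i * ((X i true x : ℤ) - X i false x) := by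
      push_cast
      rw [← Finset.sum_sub_distrib, Fintype.sum_prod_type]
      refine Finset.sum_congr rfl fun i _ => ?_
      rw [Fintype.sum_bool]
      have h2 : ((BlockIndex.coeff u b' b j i).toNat : ℤ) - (-BlockIndex.coeff u b' b j i).toNat
          = BlockIndex.coeff u b' b j i := by omega
      conv_rhs => rw [← h2]
      simp only [c, if_true, Bool.false_eq_true, if_false, reduceCtorEq]
      ring
    rw [h1]
    simp only [hX, Finset.mul_sum]
    rw [Finset.sum_comm]
    refine Finset.sum_congr rfl fun z _ => ?_
    rw [← BlockIndex.sum_coeff_mul_coeff u hb j z, Finset.sum_mul]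
    exact Finset.sum_congr rfl fun i _ => (mul_assoc _ _ _).symm
  · have h2 := Realizes.testBit_sum (X := fun i : BlockIndex T r b × Bool => X i.1 i.2) hR c
    convert h2 using 2
    simp only [hc]
    rw [Fintype.sum_prod_type]
    simp only [Finset.sum_const, Finset.card_univ, Fintype.card_bool, smul_eq_mul]
    rw [← Finset.mul_sum, Finset.sum_add_distrib, ← Finset.mul_sum,
      BlockIndex.sum_sum_natAbs_coeff u hb hu, ← BlockIndex.card_eq b']
    simp
    ring

/-! ### The trace of a cube through the tensor power of the algorithm -/

namespace FastMatMul

variable {T r : ℕ} (F : FastMatMul T r)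

/-- The identity of coefficients expressed by the correctness of the algorithm. -/
theorem sum_w_mul_u_mul_v (i j p q p' q' : Fin T) :
    ∑ k, F.u k p q * F.v k p' q' * F.w k i j = if p = i ∧ q = p' ∧ q' = j then 1 else 0 := by
  -- Evaluating on matrix units extracts a single coefficient of the bilinear identity.
  have h := F.correct (Matrix.single p q 1) (Matrix.single p' q' 1) i j
  have hsum : ∀ (c : Matrix (Fin T) (Fin T) ℤ) (p q : Fin T),
      ∑ a, ∑ b, c a b * Matrix.single p q (1 : ℤ) a b = c p q := by
    intro c p q
    rw [Finset.sum_eq_single p, Finset.sum_eq_single q]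
    · simp
    · intro b _ hb
      simp [Ne.symm hb]
    · simp
    · intro a _ ha
      exact Finset.sum_eq_zero fun b _ => by simp [Ne.symm ha]
    · simp
  simp only [hsum] at h
  rw [Finset.sum_congr rfl fun k _ => mul_comm (F.u k p q * F.v k p' q') (F.w k i j), ← h]
  by_cases hq : q = p'
  · subst hq
    rw [Matrix.single_mul_single_same]
    simp [Matrix.single_apply]
  · rw [Matrix.single_mul_single_of_ne _ _ _ _ hq]
    simp [hq]

variable {l : ℕ}

/-- The tensor power of the identity of coefficients. -/
theorem sum_prod_w_mul_u_mul_v (z₁ z₂ z₃ : Fin l → Fin T × Fin T) :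
    ∑ κ : Fin l → Fin r, (∏ t, F.u (κ t) (z₁ t).1 (z₁ t).2) * (∏ t, F.v (κ t) (z₂ t).1 (z₂ t).2) *
      (∏ t, F.w (κ t) (z₃ t).1 (z₃ t).2) =
    if (∀ t, (z₁ t).1 = (z₃ t).1) ∧ (∀ t, (z₁ t).2 = (z₂ t).1) ∧ ∀ t, (z₂ t).2 = (z₃ t).2
      then 1 else 0 := by
  simp only [← Finset.prod_mul_distrib]
  rw [← Fintype.prod_sum fun t k => F.u k (z₁ t).1 (z₁ t).2 * F.v k (z₂ t).1 (z₂ t).2 *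
    F.w k (z₃ t).1 (z₃ t).2]
  simp only [sum_w_mul_u_mul_v]
  rw [Finset.prod_ite_zero]
  simp [forall_and]

/-- The trace of a cube as a sum of products of three linear forms. -/
theorem trace_pow_three (A : Matrix (Fin l → Fin T) (Fin l → Fin T) ℤ) :
    Matrix.trace (A ^ 3) = ∑ κ : Fin l → Fin r,
      (∑ z : Fin l → Fin T × Fin T, (∏ t, F.u (κ t) (z t).1 (z t).2) *
        A (fun t => (z t).1) (fun t => (z t).2)) *
      (∑ z : Fin l → Fin T × Fin T, (∏ t, F.v (κ t) (z t).1 (z t).2) *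
        A (fun t => (z t).1) (fun t => (z t).2)) *
      (∑ z : Fin l → Fin T × Fin T, (∏ t, F.w (κ t) (z t).1 (z t).2) *
        A (fun t => (z t).2) (fun t => (z t).1)) := by
  have h1 : ∀ κ : Fin l → Fin r,
      (∑ z : Fin l → Fin T × Fin T, (∏ t, F.u (κ t) (z t).1 (z t).2) *
        A (fun t => (z t).1) (fun t => (z t).2)) *
      (∑ z : Fin l → Fin T × Fin T, (∏ t, F.v (κ t) (z t).1 (z t).2) *
        A (fun t => (z t).1) (fun t => (z t).2)) *
      (∑ z : Fin l → Fin T × Fin T, (∏ t, F.w (κ t) (z t).1 (z t).2) *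
        A (fun t => (z t).2) (fun t => (z t).1)) =
      ∑ z₁ : Fin l → Fin T × Fin T, ∑ z₂ : Fin l → Fin T × Fin T, ∑ z₃ : Fin l → Fin T × Fin T,
        ((∏ t, F.u (κ t) (z₁ t).1 (z₁ t).2) * (∏ t, F.v (κ t) (z₂ t).1 (z₂ t).2) *
          (∏ t, F.w (κ t) (z₃ t).1 (z₃ t).2)) *
        (A (fun t => (z₁ t).1) (fun t => (z₁ t).2) * A (fun t => (z₂ t).1) (fun t => (z₂ t).2) *
          A (fun t => (z₃ t).2) (fun t => (z₃ t).1)) := by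
    intro κ
    rw [Finset.sum_mul_sum, Finset.sum_mul]
    refine Finset.sum_congr rfl fun z₁ _ => ?_
    rw [Finset.sum_mul_sum]
    refine Finset.sum_congr rfl fun z₂ _ => Finset.sum_congr rfl fun z₃ _ => ?_
    ring
  have h2 : ∀ f : (Fin l → Fin T) → (Fin l → Fin T) → ℤ,
      ∑ z : Fin l → Fin T × Fin T, f (fun t => (z t).1) (fun t => (z t).2) = ∑ p, ∑ q, f p q := by
    intro f
    rw [← Fintype.sum_prod_type']
    exact Fintype.sum_equiv (Equiv.arrowProdEquivProdArrow (Fin l) (fun _ => Fin T) fun _ => Fin T)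
      _ _ fun _ => rfl
  -- Once the sum over `κ` is innermost, the tensor identity turns it into the indicator of matching
  -- indices. The third form reads `A` transposed, so what remains is the sum of `A p q * A q q' * A
  -- q' p`.
  simp only [h1]
  rw [Finset.sum_comm]
  simp only [Finset.sum_comm (s := (Finset.univ : Finset (Fin l → Fin r))), ← Finset.sum_mul,
    sum_prod_w_mul_u_mul_v, ← funext_iff]
  rw [h2 fun p q => ∑ z₂ : Fin l → Fin T × Fin T, ∑ z₃ : Fin l → Fin T × Fin T,
    (if (p = fun t => (z₃ t).1) ∧ (q = fun t => (z₂ t).1) ∧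
      (fun t => (z₂ t).2) = fun t => (z₃ t).2 then (1 : ℤ) else 0) *
    (A p q * A (fun t => (z₂ t).1) (fun t => (z₂ t).2) *
      A (fun t => (z₃ t).2) (fun t => (z₃ t).1))]
  have h3 : ∀ p q : Fin l → Fin T, (∑ z₂ : Fin l → Fin T × Fin T, ∑ z₃ : Fin l → Fin T × Fin T,
      (if (p = fun t => (z₃ t).1) ∧ (q = fun t => (z₂ t).1) ∧
        (fun t => (z₂ t).2) = fun t => (z₃ t).2 then (1 : ℤ) else 0) *
      (A p q * A (fun t => (z₂ t).1) (fun t => (z₂ t).2) *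
        A (fun t => (z₃ t).2) (fun t => (z₃ t).1))) = ∑ q', A p q * A q q' * A q' p := by
    intro p q
    rw [h2 fun p' q' => ∑ z₃ : Fin l → Fin T × Fin T,
      (if (p = fun t => (z₃ t).1) ∧ q = p' ∧ q' = fun t => (z₃ t).2 then (1 : ℤ) else 0) *
      (A p q * A p' q' * A (fun t => (z₃ t).2) (fun t => (z₃ t).1)), Finset.sum_comm]
    refine Finset.sum_congr rfl fun q' _ => ?_
    rw [Finset.sum_congr rfl fun p' _ => h2 fun i j =>
      (if p = i ∧ q = p' ∧ q' = j then (1 : ℤ) else 0) * (A p q * A p' q' * A j i)]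
    simp [ite_and]
  rw [Finset.sum_congr rfl fun p _ => Finset.sum_congr rfl fun q _ => h3 p q]
  simp only [Matrix.trace, Matrix.diag, pow_succ, pow_zero, one_mul, Matrix.mul_apply,
    Finset.sum_mul]
  refine Finset.sum_congr rfl fun p _ => Finset.sum_comm

end FastMatMul

/-! ### Resolving a growing prefix of the positions -/

theorem prod_fin_ite_lt {l h h' : ℕ} (hh : h ≤ h') (hl : h' ≤ l) (a b c : ℕ) :
    (∏ t : Fin l, if decide ((t : ℕ) < h) = true then a
      else if decide ((t : ℕ) < h') = true then b else c) = a ^ h * b ^ (h' - h) * c ^ (l - h') := by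
  obtain ⟨m, rfl⟩ := Nat.exists_eq_add_of_le hh
  obtain ⟨n, rfl⟩ := Nat.exists_eq_add_of_le hl
  simp only [decide_eq_true_eq, add_tsub_cancel_left]
  rw [Fin.prod_univ_eq_prod_range (fun t => if t < h then a else if t < h + m then b else c),
    Finset.prod_range_add, Finset.prod_range_add]
  congr 1
  · congr 1
    · rw [Finset.prod_congr rfl fun t ht => if_pos (Finset.mem_range.1 ht)]
      simp
    · rw [Finset.prod_congr rfl (g := fun _ => b) fun t ht => by
        have := Finset.mem_range.1 ht
        rw [if_neg (by omega), if_pos (by omega)]]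
      simp
  · rw [Finset.prod_congr rfl (g := fun _ => c) fun t ht => by
      rw [if_neg (by omega), if_neg (by omega)]]
    simp

namespace RealizesBlocks

variable {T r l : ℕ} {ι : Type} [Fintype ι] {u : Fin r → Matrix (Fin T) (Fin T) ℤ} {W M : ℕ}

/-- The start of the recursion: with no position resolved, the coefficients are Kronecker deltas and
the blocks are the entries. -/
theorem of_entries {Y : BlockIndex T r (fun _ : Fin l => false) → Bool → (ι → Bool) → ℕ} {D s : ℕ}
    (hM : ∀ z σ x, Y z σ x ≤ M)
    (hY : Realizes D s fun (p : (BlockIndex T r (fun _ : Fin l => false) × Bool) × Fin W) x =>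
      (Y p.1.1 p.1.2 x).testBit p.2) :
    RealizesBlocks u W M (fun z x => (Y z true x : ℤ) - Y z false x) (fun _ => false) D s := by
  refine ⟨Y, by simpa using hM, fun j x => ?_, hY⟩
  have : ∀ j z : Fin l → Fin T × Fin T,
      BlockIndex.coeff u (fun _ : Fin l => false) (fun _ => false) j z = if j = z then 1 else 0 := by
    intro j z
    refine (Finset.prod_ite_zero (p := fun t => j t = z t) (f := fun _ => (1 : ℤ))).trans ?_
    simp [funext_iff]
  symm
  exact (Finset.sum_congr rfl fun z _ => congrArg (· * _) (this j z)).trans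
    (Slot.sum_delta_mul (α := Fin l → Fin T × Fin T) j
      fun z => (Y z true x : ℤ) - Y z false x)

/-- Iterates `step`, stage `i` ending with the first `h (i + 1)` positions resolved. The factor `3`
in `hE` pays twice for the total weight and once for the number of new blocks; the latter is covered
by the same bound because `r ≤ S`. -/
theorem chain (hu : ∀ k p q, (u k p q).natAbs ≤ 1)
    {a : BlockIndex T r (fun _ : Fin l => false) → (ι → Bool) → ℤ} {D s E S : ℕ}
    (hS : FastMatMul.numTerms u ≤ S) (hr : r ≤ S) {h : ℕ → ℕ} (hmono : Monotone h)
    (h0 : h 0 = 0) {d : ℕ} (hd : h d = l)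
    (hE : ∀ i < d, 3 * (r ^ h i * S ^ (h (i + 1) - h i) * (T ^ 2) ^ (l - h (i + 1))) ≤ E)
    (H : RealizesBlocks u W M a (fun _ => false) D s) :
    RealizesBlocks u W M a (fun _ => true) (D + 2 * d) (s + d * (2 * W * E)) := by
  have key : ∀ i ≤ d, RealizesBlocks u W M a (fun t => decide ((t : ℕ) < h i)) (D + 2 * i)
      (s + i * (2 * W * E)) := by
    intro i
    induction i with
    | zero =>
      intro _
      simpa [h0] using H
    | succ i ih =>
      intro hi
      have hle : h i ≤ h (i + 1) := hmono (Nat.le_succ i)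
      have hl : h (i + 1) ≤ l := hd ▸ hmono hi
      have hst := (ih (by omega)).step hu
        (b' := fun t : Fin l => decide ((t : ℕ) < h (i + 1))) (by
          intro t
          simp only [Bool.le_iff_imp, decide_eq_true_eq]
          omega)
      obtain ⟨X, h1, h2, h3⟩ := hst
      refine ⟨X, h1, h2, ?_⟩
      have hcard : (∏ t : Fin l, if decide ((t : ℕ) < h (i + 1)) = true then r else T ^ 2)
          = r ^ h i * r ^ (h (i + 1) - h i) * (T ^ 2) ^ (l - h (i + 1)) := by
        rw [← prod_fin_ite_lt hle hl]
        refine Finset.prod_congr rfl fun t _ => ?_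
        simp only [decide_eq_true_eq]
        split_ifs <;> first | rfl | omega
      rw [hcard, prod_fin_ite_lt hle hl] at h3
      refine Realizes.mono h3 ?_
      have e1 : r ^ h i * FastMatMul.numTerms u ^ (h (i + 1) - h i) * (T ^ 2) ^ (l - h (i + 1))
          ≤ r ^ h i * S ^ (h (i + 1) - h i) * (T ^ 2) ^ (l - h (i + 1)) := by gcongr
      have e2 : r ^ h i * r ^ (h (i + 1) - h i) * (T ^ 2) ^ (l - h (i + 1))
          ≤ r ^ h i * S ^ (h (i + 1) - h i) * (T ^ 2) ^ (l - h (i + 1)) := by gcongr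
      have e3 := hE i (by omega)
      calc _ ≤ s + i * (2 * W * E) + 2 * W * E :=
            Nat.add_le_add_left (Nat.mul_le_mul_left _ (by omega)) _
        _ = _ := by ring
  have hfin := key d le_rfl
  have : (fun t : Fin l => decide ((t : ℕ) < h d)) = fun _ => true := by
    funext t
    simp [hd]
  rwa [this] at hfin

end RealizesBlocks

/-! ### Thresholds of sums of triple products -/

/-- The sign carried by a part of a number written as a difference. -/
def partSign (σ : Bool) : ℤ := if σ = true then 1 else -1

theorem sum_partSign_testBit {W m n : ℕ} (hm : m < 2 ^ W) (hn : n < 2 ^ W) :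
    (∑ p : Bool × Fin W, if (bif p.1 then m else n).testBit p.2 = true
      then partSign p.1 * 2 ^ (p.2 : ℕ) else 0) = (m : ℤ) - n := by
  have hm' := congrArg (Nat.cast (R := ℤ)) (sum_testBit_of_lt hm)
  have hn' := congrArg (Nat.cast (R := ℤ)) (sum_testBit_of_lt hn)
  push_cast at hm' hn'
  rw [Fintype.sum_prod_type, Fintype.sum_bool]
  conv_rhs => rw [← hm', ← hn', sub_eq_add_neg, ← Finset.sum_neg_distrib]
  congr 1
  · simp [partSign]
  · refine Finset.sum_congr rfl fun k _ => ?_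
    simp only [partSign, cond_false, Bool.false_eq_true, if_false]
    split_ifs <;> simp

theorem sum_ite_sumElim {α β : Type} [Fintype α] [Fintype β] {ι : Type} (f : α → ι → Bool)
    (g : β → ι → Bool) (x : ι) (v : α → ℤ) (w : β → ℤ) :
    (∑ i, if Sum.elim f g i x = true then Sum.elim v w i else 0) =
      (∑ i, if f i x = true then v i else 0) + ∑ i, if g i x = true then w i else 0 :=
  Fintype.sum_sum_type _

theorem decide_three_le_eq_and (b₁ b₂ b₃ : Bool) :
    decide ((3 : ℤ) ≤ (if b₁ = true then 1 else 0) +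
      ((if b₂ = true then 1 else 0) + if b₃ = true then 1 else 0)) = (b₁ && (b₂ && b₃)) := by
  cases b₁ <;> cases b₂ <;> cases b₃ <;> decide

theorem sum_mul_sum_mul_sum {α β γ : Type} [Fintype α] [Fintype β] [Fintype γ] (f : α → ℤ)
    (g : β → ℤ) (h : γ → ℤ) :
    (∑ a, f a) * ((∑ b, g b) * ∑ c, h c) = ∑ q : α × β × γ, f q.1 * (g q.2.1 * h q.2.2) := by
  rw [Fintype.sum_prod_type, Finset.sum_mul]
  refine Finset.sum_congr rfl fun a _ => ?_
  rw [Fintype.sum_prod_type, Finset.sum_mul, Finset.mul_sum]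
  refine Finset.sum_congr rfl fun b _ => ?_
  rw [Finset.mul_sum, Finset.mul_sum]

/-- A threshold gate on a sum of products of three integers, from the binary digits of the factors,
in depth two. -/
theorem Realizes.le_sum_mul_mul {ι κ : Type} [Fintype ι] [Fintype κ] {D s₁ s₂ s₃ W : ℕ}
    {X₁ X₂ X₃ : κ → Bool → (ι → Bool) → ℕ}
    (h₁ : Realizes D s₁ fun (p : (κ × Bool) × Fin W) x => (X₁ p.1.1 p.1.2 x).testBit p.2)
    (h₂ : Realizes D s₂ fun (p : (κ × Bool) × Fin W) x => (X₂ p.1.1 p.1.2 x).testBit p.2)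
    (h₃ : Realizes D s₃ fun (p : (κ × Bool) × Fin W) x => (X₃ p.1.1 p.1.2 x).testBit p.2)
    (hW₁ : ∀ j σ x, X₁ j σ x < 2 ^ W) (hW₂ : ∀ j σ x, X₂ j σ x < 2 ^ W)
    (hW₃ : ∀ j σ x, X₃ j σ x < 2 ^ W) (τ : ℤ) :
    Realizes (D + 1 + 1) (s₁ + (s₂ + s₃) + Fintype.card κ * (2 * W) ^ 3 + 1) fun (_ : Unit) x =>
      decide (τ ≤ ∑ j, ((X₁ j true x : ℤ) - X₁ j false x) * ((X₂ j true x : ℤ) - X₂ j false x) *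
        ((X₃ j true x : ℤ) - X₃ j false x)) := by
  classical
  -- Each factor is a signed sum of its digits, so a product expands into `(2 * W) ^ 3` products of
  -- three digits. Each of these is a conjunction, that is, a gate of threshold `3`, and the output
  -- gate weights them by signed powers of two.
  have hand := (h₁.sum (h₂.sum h₃)).layer
    (σ' := κ × (Bool × Fin W) × (Bool × Fin W) × (Bool × Fin W))
    (g := fun q x => ((X₁ q.1 q.2.1.1 x).testBit q.2.1.2 &&
      ((X₂ q.1 q.2.2.1.1 x).testBit q.2.2.1.2 && (X₃ q.1 q.2.2.2.1 x).testBit q.2.2.2.2)))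
    (fun q => Sum.elim (fun p => if p = ((q.1, q.2.1.1), q.2.1.2) then 1 else 0)
      (Sum.elim (fun p => if p = ((q.1, q.2.2.1.1), q.2.2.1.2) then 1 else 0)
        (fun p => if p = ((q.1, q.2.2.2.1), q.2.2.2.2) then 1 else 0)))
    (fun _ => 3) ?_
  swap
  · intro q x
    have hs : ∀ (f : (κ × Bool) × Fin W → (ι → Bool) → Bool) (p₀ : (κ × Bool) × Fin W),
        (∑ p, if f p x = true then (if p = p₀ then (1 : ℤ) else 0) else 0)
          = if f p₀ x = true then 1 else 0 := by
      intro f p₀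
      rw [Finset.sum_eq_single p₀]
      · simp
      · intro p _ hp
        simp [hp]
      · simp
    rw [sum_ite_sumElim, sum_ite_sumElim, hs (fun p x => (X₁ p.1.1 p.1.2 x).testBit p.2),
      hs (fun p x => (X₂ p.1.1 p.1.2 x).testBit p.2),
      hs (fun p x => (X₃ p.1.1 p.1.2 x).testBit p.2)]
    exact (decide_three_le_eq_and _ _ _).symm
  have hout := hand.layer (σ' := Unit)
    (g := fun _ x => decide (τ ≤ ∑ j, ((X₁ j true x : ℤ) - X₁ j false x) *
      ((X₂ j true x : ℤ) - X₂ j false x) * ((X₃ j true x : ℤ) - X₃ j false x)))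
    (fun _ q => (partSign q.2.1.1 * 2 ^ (q.2.1.2 : ℕ)) * ((partSign q.2.2.1.1 *
      2 ^ (q.2.2.1.2 : ℕ)) * (partSign q.2.2.2.1 * 2 ^ (q.2.2.2.2 : ℕ))))
    (fun _ => τ) ?_
  · convert hout using 1
    simp only [Fintype.card_prod, Fintype.card_bool, Fintype.card_fin, Fintype.card_unit]
    ring
  · intro _ x
    congr 2
    rw [Fintype.sum_prod_type]
    refine Finset.sum_congr rfl fun j _ => ?_
    have hp : ∀ (X : κ → Bool → (ι → Bool) → ℕ), (∀ j σ x, X j σ x < 2 ^ W) →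
        (X j true x : ℤ) - X j false x = ∑ p : Bool × Fin W,
          if (X j p.1 x).testBit p.2 = true then partSign p.1 * 2 ^ (p.2 : ℕ) else 0 := by
      intro X hX
      rw [← sum_partSign_testBit (hX j true x) (hX j false x)]
      refine Finset.sum_congr rfl fun p _ => ?_
      rcases p with ⟨_ | _, k⟩ <;> rfl
    rw [hp X₁ hW₁, hp X₂ hW₂, hp X₃ hW₃, mul_assoc, sum_mul_sum_mul_sum]
    refine Finset.sum_congr rfl fun q _ => ?_
    cases (X₁ j q.1.1 x).testBit q.1.2 <;> cases (X₂ j q.2.1.1 x).testBit q.2.1.2 <;>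
      cases (X₃ j q.2.2.1 x).testBit q.2.2.2 <;> simp

/-! ### The trace circuit for an arbitrary schedule -/

namespace FastMatMul

variable {T r : ℕ} (F : FastMatMul T r)

theorem numTerms_u_le : numTerms F.u ≤ F.sparsity := le_max_left _ _

theorem numTerms_v_le : numTerms F.v ≤ F.sparsity := le_max_of_le_right (le_max_left _ _)

theorem numTerms_w_le : numTerms F.w ≤ F.sparsity := le_max_of_le_right (le_max_right _ _)

/-- Each of the `r` products contains at least one entry of `A`. -/
theorem le_sparsity : r ≤ F.sparsity := by
  refine le_trans ?_ F.numTerms_u_le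
  have : ∀ k, 1 ≤ (Finset.univ.filter fun pq : Fin T × Fin T => F.u k pq.1 pq.2 ≠ 0).card := by
    intro k
    obtain ⟨p, q, h⟩ := F.u_nonempty k
    exact Finset.card_pos.2 ⟨(p, q), by simpa using h⟩
  calc r = ∑ _k : Fin r, 1 := by simp
    _ ≤ _ := Finset.sum_le_sum fun k _ => this k

/-- The circuit comparing the trace of a cube with `τ`, for a schedule `h` of resolved levels. -/
theorem exists_trace_circuit {ι : Type} [Fintype ι] {l W M D s d E : ℕ}
    {Y : (Fin l → Fin T) → (Fin l → Fin T) → Bool → (ι → Bool) → ℕ}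
    (hM : ∀ p q σ x, Y p q σ x ≤ M)
    (hY : Realizes D s fun (p : (((Fin l → Fin T) × (Fin l → Fin T)) × Bool) × Fin W) x =>
      (Y p.1.1.1 p.1.1.2 p.1.2 x).testBit p.2)
    (hW : M * (T ^ 2) ^ l < 2 ^ W) {h : ℕ → ℕ} (hmono : Monotone h) (h0 : h 0 = 0) (hd : h d = l)
    (hE : ∀ i < d,
      3 * (r ^ h i * F.sparsity ^ (h (i + 1) - h i) * (T ^ 2) ^ (l - h (i + 1))) ≤ E) (τ : ℤ) :
    ∃ C : ThresholdCircuit ι, C.depth ≤ D + 2 * d + 2 ∧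
      C.size ≤ 3 * (s + d * (2 * W * E)) + r ^ l * (2 * W) ^ 3 + 1 ∧
      ∀ x, C.eval x = true ↔
        τ ≤ Matrix.trace ((Matrix.of fun p q => (Y p q true x : ℤ) - Y p q false x) ^ 3) := by
  have habs : ∀ z : ℤ, z = -1 ∨ z = 0 ∨ z = 1 → z.natAbs ≤ 1 := by
    rintro z (rfl | rfl | rfl) <;> decide
  let Y₁ : BlockIndex T r (fun _ : Fin l => false) → Bool → (ι → Bool) → ℕ := fun z σ x =>
    Y (fun t => (z t : Fin T × Fin T).1) (fun t => (z t : Fin T × Fin T).2) σ x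
  -- The transposed entries, needed for the third linear form.
  let Y₂ : BlockIndex T r (fun _ : Fin l => false) → Bool → (ι → Bool) → ℕ := fun z σ x =>
    Y (fun t => (z t : Fin T × Fin T).2) (fun t => (z t : Fin T × Fin T).1) σ x
  have hY₁ : Realizes D s fun (p : (BlockIndex T r (fun _ : Fin l => false) × Bool) × Fin W) x =>
      (Y₁ p.1.1 p.1.2 x).testBit p.2 :=
    hY.comp fun p : ((Fin l → Fin T × Fin T) × Bool) × Fin W =>
      (((fun t => (p.1.1 t).1, fun t => (p.1.1 t).2), p.1.2), p.2)
  have hY₂ : Realizes D s fun (p : (BlockIndex T r (fun _ : Fin l => false) × Bool) × Fin W) x =>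
      (Y₂ p.1.1 p.1.2 x).testBit p.2 :=
    hY.comp fun p : ((Fin l → Fin T × Fin T) × Bool) × Fin W =>
      (((fun t => (p.1.1 t).2, fun t => (p.1.1 t).1), p.1.2), p.2)
  have hU := (RealizesBlocks.of_entries (u := F.u) (Y := Y₁)
    (fun z σ x => hM _ _ σ x) hY₁).chain
    (fun k p q => habs _ (F.u_weight k p q)) F.numTerms_u_le F.le_sparsity hmono h0 hd hE
  have hV := (RealizesBlocks.of_entries (u := F.v) (Y := Y₁)
    (fun z σ x => hM _ _ σ x) hY₁).chain
    (fun k p q => habs _ (F.v_weight k p q)) F.numTerms_v_le F.le_sparsity hmono h0 hd hE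
  have hV' := (RealizesBlocks.of_entries (u := F.w) (Y := Y₂)
    (fun z σ x => hM _ _ σ x) hY₂).chain
    (fun k p q => habs _ (F.w_weight k p q)) F.numTerms_w_le F.le_sparsity hmono h0 hd hE
  obtain ⟨X₁, hM₁, hX₁, hR₁⟩ := hU
  obtain ⟨X₂, hM₂, hX₂, hR₂⟩ := hV
  obtain ⟨X₃, hM₃, hX₃, hR₃⟩ := hV'
  have hlt : M * (∏ _t : Fin l, if true = true then T ^ 2 else 1) < 2 ^ W := by simpa using hW
  obtain ⟨C, hC1, hC2, hC3⟩ := (Realizes.le_sum_mul_mul hR₁ hR₂ hR₃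
    (fun j σ x => (hM₁ j σ x).trans_lt hlt) (fun j σ x => (hM₂ j σ x).trans_lt hlt)
    (fun j σ x => (hM₃ j σ x).trans_lt hlt) τ).exists_circuit ()
  refine ⟨C, hC1, hC2.trans (le_of_eq ?_), fun x => ?_⟩
  · rw [BlockIndex.card_eq]
    simp
    ring
  · rw [hC3, decide_eq_true_eq]
    simp only [hX₁, hX₂, hX₃]
    rw [F.trace_pow_three]
    exact Iff.rfl

end FastMatMul

/-! ### Costs as powers of `β`, and the choice of the schedule -/

namespace FastMatMul

variable {T r : ℕ} (F : FastMatMul T r)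

theorem cast_sparsity_pos (hr : T ^ 2 < r) : (0 : ℝ) < F.sparsity := by
  exact_mod_cast (Nat.zero_lt_of_lt hr).trans_le F.le_sparsity

theorem one_lt_beta (hT : 2 ≤ T) (hr : T ^ 2 < r) : 1 < F.beta := by
  have hT0 : (0 : ℝ) < T := by exact_mod_cast (by omega : 0 < T)
  rw [beta, one_lt_div (by positivity)]
  exact_mod_cast hr.trans_le F.le_sparsity

theorem alpha_pos (hr : T ^ 2 < r) : 0 < F.alpha :=
  div_pos (by exact_mod_cast Nat.zero_lt_of_lt hr) (F.cast_sparsity_pos hr)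

theorem one_le_one_div_alpha (hr : T ^ 2 < r) : 1 ≤ 1 / F.alpha := by
  rw [alpha, one_div_div, one_le_div (by exact_mod_cast Nat.zero_lt_of_lt hr)]
  exact_mod_cast F.le_sparsity

theorem gamma_nonneg (hT : 2 ≤ T) (hr : T ^ 2 < r) : 0 ≤ F.gamma :=
  Real.logb_nonneg (F.one_lt_beta hT hr) (F.one_le_one_div_alpha hr)

theorem alpha_mul_beta (hr : T ^ 2 < r) : F.alpha * F.beta = r / (T : ℝ) ^ 2 := by
  have := (F.cast_sparsity_pos hr).ne'
  rw [alpha, beta]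
  field_simp

/-- The claim amounts to `1 / α < β`, that is `α * β > 1`, and `α * β = r / T ^ 2`. -/
theorem gamma_lt_one (hT : 2 ≤ T) (hr : T ^ 2 < r) : F.gamma < 1 := by
  have hT0 : (0 : ℝ) < T := by exact_mod_cast (by omega : 0 < T)
  have hα := F.alpha_pos hr
  rw [gamma, Real.logb_lt_iff_lt_rpow (F.one_lt_beta hT hr) (by positivity), Real.rpow_one,
    div_lt_iff₀ hα, mul_comm, F.alpha_mul_beta hr, one_lt_div (by positivity)]
  exact_mod_cast hr

theorem beta_rpow_neg_gamma (hT : 2 ≤ T) (hr : T ^ 2 < r) : F.beta ^ (-F.gamma) = F.alpha := by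
  have hβ := F.one_lt_beta hT hr
  have hα := F.alpha_pos hr
  rw [Real.rpow_neg (by linarith), gamma, Real.rpow_logb (by linarith) hβ.ne' (by positivity),
    one_div, inv_inv]

/-- The cost of passing from level `h` to level `h'`, as a power of `β`. -/
theorem level_cost_eq (hT : 2 ≤ T) (hr : T ^ 2 < r) {l h h' : ℕ} (hh : h ≤ h') (hl : h' ≤ l) :
    (r : ℝ) ^ h * (F.sparsity : ℝ) ^ (h' - h) * ((T : ℝ) ^ 2) ^ (l - h')
      = (r : ℝ) ^ l * F.beta ^ ((h' : ℝ) - F.gamma * h - (1 - F.gamma) * l) := by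
  have hβ : 0 < F.beta := one_pos.trans (F.one_lt_beta hT hr)
  have hT0 : (0 : ℝ) < T := by exact_mod_cast (by omega : 0 < T)
  have hs := F.cast_sparsity_pos hr
  have hα := F.alpha_pos hr
  -- With `s = β * T ^ 2` and `r = α * β * T ^ 2` the cost is `T ^ (2 * l) * α ^ h * β ^ h'`, while
  -- `r ^ l` is `T ^ (2 * l) * (α * β) ^ l`; then `α = β ^ (-γ)` makes the quotient a power of `β`.
  have e1 : F.beta ^ ((h' : ℝ) - F.gamma * h - (1 - F.gamma) * l)
      = F.beta ^ h' * F.alpha ^ h * ((F.alpha * F.beta) ^ l)⁻¹ := by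
    rw [mul_pow, mul_inv, ← F.beta_rpow_neg_gamma hT hr, ← Real.rpow_natCast _ h',
      ← Real.rpow_mul_natCast hβ.le, ← Real.rpow_mul_natCast hβ.le, ← Real.rpow_natCast _ l,
      ← Real.rpow_neg hβ.le, ← Real.rpow_neg hβ.le, ← Real.rpow_add hβ, ← Real.rpow_add hβ,
      ← Real.rpow_add hβ]
    congr 1
    ring
  have hr0 : (0 : ℝ) < r := by exact_mod_cast Nat.zero_lt_of_lt hr
  obtain ⟨m, rfl⟩ := Nat.exists_eq_add_of_le hh
  obtain ⟨n, rfl⟩ := Nat.exists_eq_add_of_le hl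
  rw [e1, F.alpha_mul_beta hr, alpha, beta]
  simp only [add_tsub_cancel_left, div_pow, pow_add]
  field_simp

/-- The level reached after `i` of `d` steps. -/
noncomputable def schedule (l d i : ℕ) : ℕ :=
  if i < d then ⌈(1 - F.gamma ^ i) * l⌉₊ else l

/-- Relies on `γ ^ 0 = 1`, also when `γ = 0`; `hd` keeps index `0` out of the final branch. -/
theorem schedule_zero {d : ℕ} (hd : 1 ≤ d) (l : ℕ) : F.schedule l d 0 = 0 := by
  have : 0 < d := hd
  simp [schedule, this]

theorem schedule_self (l d : ℕ) : F.schedule l d d = l := by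
  simp [schedule]

theorem schedule_mono (hT : 2 ≤ T) (hr : T ^ 2 < r) (l d : ℕ) : Monotone (F.schedule l d) := by
  have h0 := F.gamma_nonneg hT hr
  have h1 := (F.gamma_lt_one hT hr).le
  intro i j hij
  unfold schedule
  split_ifs with hi hj
  · refine Nat.ceil_mono (mul_le_mul_of_nonneg_right ?_ (Nat.cast_nonneg l))
    have := pow_le_pow_of_le_one h0 h1 hij
    linarith
  · refine Nat.ceil_le.2 ?_
    have := pow_nonneg h0 i
    nlinarith [Nat.cast_nonneg (α := ℝ) l]
  · omega
  · exact le_rfl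

/-- The unrounded levels `(1 - γ ^ i) * l` solve `h_{i+1} - γ * h_i = (1 - γ) * l`. Ending at `l`
instead of `(1 - γ ^ d) * l` adds `γ ^ d * l` in the last step only, and rounding up adds at most
`1`. -/
theorem schedule_gap_le (hT : 2 ≤ T) (hr : T ^ 2 < r) (l : ℕ) {d i : ℕ} (hi : i < d) :
    (F.schedule l d (i + 1) : ℝ) - F.gamma * F.schedule l d i - (1 - F.gamma) * l
      ≤ F.gamma ^ d * l + 1 := by
  have h0 := F.gamma_nonneg hT hr
  have hl := Nat.cast_nonneg (α := ℝ) l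
  have hlow : (1 - F.gamma ^ i) * l ≤ (F.schedule l d i : ℝ) := by
    rw [schedule, if_pos hi]
    exact Nat.le_ceil _
  have hmul := mul_le_mul_of_nonneg_left hlow h0
  have hp : F.gamma ^ (i + 1) = F.gamma * F.gamma ^ i := pow_succ' _ _
  have hd0 : 0 ≤ F.gamma ^ d * l := mul_nonneg (pow_nonneg h0 d) hl
  by_cases hi' : i + 1 < d
  · have hup : (F.schedule l d (i + 1) : ℝ) ≤ (1 - F.gamma ^ (i + 1)) * l + 1 := by
      rw [schedule, if_pos hi']
      refine (Nat.ceil_lt_add_one (mul_nonneg ?_ hl)).le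
      have := pow_le_one₀ h0 (F.gamma_lt_one hT hr).le (n := i + 1)
      linarith
    rw [hp] at hup
    nlinarith
  · obtain rfl : d = i + 1 := by omega
    rw [F.schedule_self, hp]
    rw [hp] at hd0
    nlinarith

theorem level_cost_le (hT : 2 ≤ T) (hr : T ^ 2 < r) (l : ℕ) {d i : ℕ} (hi : i < d) :
    (r : ℝ) ^ F.schedule l d i *
        (F.sparsity : ℝ) ^ (F.schedule l d (i + 1) - F.schedule l d i) *
        ((T : ℝ) ^ 2) ^ (l - F.schedule l d (i + 1))
      ≤ F.beta * ((r : ℝ) ^ l * F.beta ^ (F.gamma ^ d * l)) := by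
  have hβ := F.one_lt_beta hT hr
  have hmono := F.schedule_mono hT hr l d
  have hle : F.schedule l d (i + 1) ≤ l :=
    (hmono (Nat.succ_le_of_lt hi)).trans_eq (F.schedule_self l d)
  rw [F.level_cost_eq hT hr (hmono (Nat.le_succ i)) hle, mul_left_comm]
  refine mul_le_mul_of_nonneg_left ?_ (by positivity)
  refine (Real.rpow_le_rpow_of_exponent_le hβ.le (F.schedule_gap_le hT hr l hi)).trans_eq ?_
  -- The rounding error `1` in the exponent becomes the constant factor `β`.
  rw [Real.rpow_add_one (by linarith), mul_comm]

/-- Converts to powers of `N = T ^ l`: `N ^ ω = r ^ l`, and `N ^ (log_T β)` is `β ^ l`, which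
dictates the constant `c`. -/
theorem pow_rpow_omega_add (hT : 2 ≤ T) (hr : T ^ 2 < r) (l : ℕ) (g : ℝ) :
    ((T : ℝ) ^ l) ^ (F.omega + Real.logb T F.beta * g) = (r : ℝ) ^ l * F.beta ^ (g * l) := by
  have hT1 : (1 : ℝ) < T := by exact_mod_cast (by omega : 1 < T)
  have hT0 : (0 : ℝ) < T := by linarith
  have hβ : 0 < F.beta := one_pos.trans (F.one_lt_beta hT hr)
  have hr0 : (0 : ℝ) < r := by exact_mod_cast Nat.zero_lt_of_lt hr
  rw [← Real.rpow_natCast_mul hT0.le, mul_add, Real.rpow_add hT0, mul_comm (l : ℝ) F.omega,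
    Real.rpow_mul_natCast hT0.le, omega, Real.rpow_logb hT0 hT1.ne' hr0,
    show (l : ℝ) * (Real.logb T F.beta * g) = Real.logb T F.beta * (g * l) by ring,
    Real.rpow_mul hT0.le, Real.rpow_logb hT0 hT1.ne' hβ]

end FastMatMul

/-! ### Reindexing of traces, and triangles as closed walks -/

theorem Matrix.trace_submatrix_pow {m n : Type} [Fintype m] [Fintype n] [DecidableEq m]
    [DecidableEq n] (A : Matrix n n ℤ) (e : m ≃ n) (k : ℕ) :
    Matrix.trace ((A.submatrix e e) ^ k) = Matrix.trace (A ^ k) := by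
  have : (A.submatrix e e) ^ k = (A ^ k).submatrix e e := by
    induction k with
    | zero => simp
    | succ k ih => rw [pow_succ, pow_succ, ih, Matrix.submatrix_mul_equiv]
  rw [this]
  exact Fintype.sum_equiv e _ _ fun _ => rfl

/-- The trace counts ordered triples of mutually adjacent vertices, and sending a triple to its
underlying set has fibres of size six over the triangles. -/
theorem SimpleGraph.trace_adjMatrix_pow_three {V : Type} [Fintype V] [DecidableEq V]
    (G : SimpleGraph V) [DecidableRel G.Adj] :
    Matrix.trace (G.adjMatrix ℤ ^ 3) = 6 * ((G.cliqueFinset 3).card : ℤ) := by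
  let S : Finset (V × V × V) := Finset.univ.filter fun p =>
    G.Adj p.1 p.2.1 ∧ G.Adj p.2.1 p.2.2 ∧ G.Adj p.2.2 p.1
  have h1 : Matrix.trace (G.adjMatrix ℤ ^ 3) = (S.card : ℤ) := by
    rw [Finset.card_filter, Fintype.sum_prod_type]
    push_cast
    simp only [Matrix.trace, Matrix.diag, pow_succ, pow_zero, one_mul, Matrix.mul_apply,
      Finset.sum_mul]
    refine Finset.sum_congr rfl fun i _ => ?_
    rw [Fintype.sum_prod_type, Finset.sum_comm]
    refine Finset.sum_congr rfl fun j _ => Finset.sum_congr rfl fun k _ => ?_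
    simp only [SimpleGraph.adjMatrix_apply]
    split_ifs <;> simp_all
  have hmaps : ∀ p ∈ S, ({p.1, p.2.1, p.2.2} : Finset V) ∈ G.cliqueFinset 3 := by
    rintro ⟨i, j, k⟩ hp
    simp only [S, Finset.mem_filter, Finset.mem_univ, true_and] at hp
    rw [SimpleGraph.mem_cliqueFinset_iff, SimpleGraph.is3Clique_iff]
    exact ⟨i, j, k, hp.1, hp.2.2.symm, hp.2.1, rfl⟩
  have hfib : ∀ s ∈ G.cliqueFinset 3,
      (S.filter fun p => ({p.1, p.2.1, p.2.2} : Finset V) = s).card = 6 := by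
    intro s hs
    rw [SimpleGraph.mem_cliqueFinset_iff, SimpleGraph.is3Clique_iff] at hs
    obtain ⟨a, b, c, hab, hac, hbc, rfl⟩ := hs
    have hne := hab.ne
    have hne' := hac.ne
    have hne'' := hbc.ne
    have : (S.filter fun p => ({p.1, p.2.1, p.2.2} : Finset V) = {a, b, c})
        = {(a, b, c), (a, c, b), (b, a, c), (b, c, a), (c, a, b), (c, b, a)} := by
      ext ⟨i, j, k⟩
      simp only [S, Finset.mem_filter, Finset.mem_univ, true_and, Finset.mem_insert,
        Finset.mem_singleton, Prod.mk.injEq]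
      constructor
      · rintro ⟨⟨hij, hjk, hki⟩, h⟩
        have h1 := hij.ne
        have h2 := hjk.ne
        have h3 := hki.ne
        have hi : i ∈ ({a, b, c} : Finset V) := by rw [← h]; simp
        have hj : j ∈ ({a, b, c} : Finset V) := by rw [← h]; simp
        have hk : k ∈ ({a, b, c} : Finset V) := by rw [← h]; simp
        simp only [Finset.mem_insert, Finset.mem_singleton] at hi hj hk
        grind
      · have e1 : ({a, c, b} : Finset V) = {a, b, c} := by grind
        have e2 : ({b, a, c} : Finset V) = {a, b, c} := by grind
        have e3 : ({b, c, a} : Finset V) = {a, b, c} := by grind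
        have e4 : ({c, a, b} : Finset V) = {a, b, c} := by grind
        have e5 : ({c, b, a} : Finset V) = {a, b, c} := by grind
        rintro (⟨rfl, rfl, rfl⟩ | ⟨rfl, rfl, rfl⟩ | ⟨rfl, rfl, rfl⟩ | ⟨rfl, rfl, rfl⟩ |
          ⟨rfl, rfl, rfl⟩ | ⟨rfl, rfl, rfl⟩) <;>
          simp [*, hab.symm, hac.symm, hbc.symm]
    rw [this]
    have := hne.symm
    have := hne'.symm
    have := hne''.symm
    simp [Finset.card_insert_of_notMem, *]
  rw [h1, Finset.card_eq_sum_card_fiberwise hmaps, Finset.sum_congr rfl hfib]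
  simp [mul_comm]

/-! ### Reading the input, and the final bounds -/

theorem sum_ite_two_pow_eq_ofBits {b : ℕ} (f : Fin b → Bool) :
    (∑ k : Fin b, if f k = true then (2 : ℤ) ^ (k : ℕ) else 0) = (Nat.ofBits f : ℤ) := by
  have h := congrArg (Nat.cast (R := ℤ)) (sum_testBit_of_lt (Nat.ofBits_lt_two_pow f))
  push_cast at h
  rw [← h]
  exact Finset.sum_congr rfl fun k _ => by rw [Nat.testBit_ofBits_lt f k k.2]

/-- Copies of inputs, some of them replaced by `false`. -/
theorem Realizes.of_option {ι σ : Type} [Fintype ι] [Fintype σ] {f : σ → (ι → Bool) → Bool}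
    (e : σ → Option ι) (hf : ∀ j x, f j x = (e j).elim false x) :
    Realizes 1 (Fintype.card σ) f := by
  classical
  refine Realizes.of_inputs (fun j i => if e j = some i then 1 else 0) (fun _ => 1) fun j x => ?_
  rw [hf]
  cases h : e j with
  | none => simp
  | some i =>
    simp only [Option.elim, Option.some.injEq]
    rw [Finset.sum_eq_single i]
    · cases x i <;> simp
    · intro i' _ hi
      simp [Ne.symm hi]
    · simp

namespace FastMatMul

variable {T r : ℕ} (F : FastMatMul T r)

/-- The circuit for the trace of a cube, the bits of the entries being inputs or `false`. -/
theorem exists_trace_circuit_of_bits (hT : 2 ≤ T) (hr : T ^ 2 < r) {ι : Type} [Fintype ι]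
    {l d b : ℕ} (hd : 1 ≤ d)
    (e : Fin (T ^ l) → Fin (T ^ l) → Bool → Fin b → Option ι) (τ : ℤ) :
    ∃ C : ThresholdCircuit ι, C.depth ≤ 2 * d + 3 ∧
      (C.size : ℝ) ≤ (15 + 18 * F.beta) * ((b + 2 * T * l + 1 : ℕ) : ℝ) ^ 3 *
        ((d : ℝ) * ((T : ℝ) ^ l) ^ (F.omega + Real.logb T F.beta * F.gamma ^ d)) ∧
      ∀ x : ι → Bool, C.eval x = true ↔ τ ≤ Matrix.trace ((Matrix.of fun i j =>
        (∑ k : Fin b, if (e i j true k).elim false x = true then (2 : ℤ) ^ (k : ℕ) else 0) -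
        (∑ k : Fin b, if (e i j false k).elim false x = true then (2 : ℤ) ^ (k : ℕ) else 0)) ^ 3) := by
  -- Resolving all positions multiplies the bound `2 ^ b` by at most `T ^ (2 * l) ≤ 2 ^ (2 * T *
  -- l)`; hence `W` digits suffice, and `W` is linear in `b` and `l`.
  set W : ℕ := b + 2 * T * l + 1 with hW
  set R : ℝ := (r : ℝ) ^ l * F.beta ^ (F.gamma ^ d * l) with hR
  have hβ := F.one_lt_beta hT hr
  have hγ := F.gamma_nonneg hT hr
  have hr1 : (1 : ℝ) ≤ r := by exact_mod_cast Nat.succ_le_of_lt (Nat.zero_lt_of_lt hr)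
  have hrl : (1 : ℝ) ≤ (r : ℝ) ^ l := one_le_pow₀ hr1
  have hrR : (r : ℝ) ^ l ≤ R := by
    refine le_mul_of_one_le_right (by linarith) (Real.one_le_rpow hβ.le ?_)
    positivity
  have hR0 : 0 ≤ R := by linarith
  let ψ : (Fin l → Fin T) ≃ Fin (T ^ l) := finFunctionFinEquiv
  let Y : (Fin l → Fin T) → (Fin l → Fin T) → Bool → (ι → Bool) → ℕ := fun p q σ x =>
    Nat.ofBits fun k => (e (ψ p) (ψ q) σ k).elim false x
  have hY : Realizes 1 (T ^ l * T ^ l * 2 * W)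
      fun (p : (((Fin l → Fin T) × (Fin l → Fin T)) × Bool) × Fin W) x =>
        (Y p.1.1.1 p.1.1.2 p.1.2 x).testBit p.2 := by
    have := Realizes.of_option (ι := ι)
      (f := fun (p : (((Fin l → Fin T) × (Fin l → Fin T)) × Bool) × Fin W) x =>
        (Y p.1.1.1 p.1.1.2 p.1.2 x).testBit p.2)
      (fun p => if h : (p.2 : ℕ) < b then e (ψ p.1.1.1) (ψ p.1.1.2) p.1.2 ⟨p.2, h⟩ else none)
      (by
        intro p x
        simp only [Y, Nat.testBit_ofBits]
        split_ifs <;> rfl)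
    simpa using this
  have hM : ∀ p q σ x, Y p q σ x ≤ 2 ^ b := fun p q σ x => (Nat.ofBits_lt_two_pow _).le
  have hMW : 2 ^ b * (T ^ 2) ^ l < 2 ^ W := by
    calc 2 ^ b * (T ^ 2) ^ l ≤ 2 ^ b * ((2 ^ T) ^ 2) ^ l := by
          gcongr
          exact Nat.lt_two_pow_self.le
      _ = 2 ^ (b + 2 * T * l) := by
          rw [← pow_mul, ← pow_mul, ← pow_add]
          congr 1
          ring
      _ < 2 ^ W := Nat.pow_lt_pow_right (by norm_num) (by omega)
  have hE : ∀ i < d, 3 * (r ^ F.schedule l d i *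
      F.sparsity ^ (F.schedule l d (i + 1) - F.schedule l d i) *
      (T ^ 2) ^ (l - F.schedule l d (i + 1))) ≤ ⌊3 * (F.beta * R)⌋₊ := by
    intro i hi
    refine Nat.le_floor ?_
    push_cast
    exact mul_le_mul_of_nonneg_left (F.level_cost_le hT hr l hi) (by norm_num)
  obtain ⟨C, hC1, hC2, hC3⟩ := F.exists_trace_circuit hM hY hMW (F.schedule_mono hT hr l d)
    (F.schedule_zero hd l) (F.schedule_self l d) hE τ
  refine ⟨C, by omega, ?_, fun x => ?_⟩
  · rw [F.pow_rpow_omega_add hT hr, ← hR]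
    have hEle : (⌊3 * (F.beta * R)⌋₊ : ℝ) ≤ 3 * (F.beta * R) := Nat.floor_le (by positivity)
    have hN : ((T : ℝ) ^ l * (T : ℝ) ^ l) ≤ R := by
      refine le_trans ?_ hrR
      rw [← mul_pow, ← sq]
      gcongr
      exact_mod_cast hr.le
    have hW1 : (1 : ℝ) ≤ W := by exact_mod_cast (by omega : 1 ≤ W)
    have hW3 : (W : ℝ) ≤ (W : ℝ) ^ 3 := le_self_pow₀ hW1 (by norm_num)
    have hd1 : (1 : ℝ) ≤ d := by exact_mod_cast hd
    have hRd : R ≤ d * R := le_mul_of_one_le_left hR0 hd1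
    have hWR : ∀ y : ℝ, 0 ≤ y → y ≤ (W : ℝ) ^ 3 → y * R ≤ (W : ℝ) ^ 3 * (d * R) :=
      fun y hy hyW => mul_le_mul hyW hRd hR0 (by positivity)
    have hsize : (C.size : ℝ) ≤ 3 * ((T : ℝ) ^ l * (T : ℝ) ^ l * 2 * W +
        d * (2 * W * ⌊3 * (F.beta * R)⌋₊)) + (r : ℝ) ^ l * (2 * W) ^ 3 + 1 := by
      exact_mod_cast hC2
    have t1 : (T : ℝ) ^ l * (T : ℝ) ^ l * W ≤ (W : ℝ) ^ 3 * (d * R) := by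
      refine le_trans ?_ (hWR W (by linarith) hW3)
      rw [mul_comm]
      gcongr
    have t2 : (d : ℝ) * (W * ⌊3 * (F.beta * R)⌋₊) ≤ 3 * F.beta * ((W : ℝ) ^ 3 * (d * R)) := by
      calc (d : ℝ) * (W * ⌊3 * (F.beta * R)⌋₊) ≤ d * ((W : ℝ) ^ 3 * (3 * (F.beta * R))) := by
            gcongr
        _ = _ := by ring
    have t3 : (r : ℝ) ^ l * (2 * W) ^ 3 ≤ 8 * ((W : ℝ) ^ 3 * (d * R)) := by
      calc (r : ℝ) ^ l * (2 * W) ^ 3 = 8 * ((W : ℝ) ^ 3 * (r : ℝ) ^ l) := by ring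
        _ ≤ _ := by
          gcongr
          exact hrR.trans hRd
    have t4 : (1 : ℝ) ≤ (W : ℝ) ^ 3 * (d * R) :=
      (hrl.trans hrR).trans ((le_of_eq (one_mul R).symm).trans
        (hWR 1 zero_le_one (one_le_pow₀ hW1)))
    -- In units of `W ^ 3 * (d * R)`: input copies give `3 * 2`, the batches `3 * 2 * 3 * β`, the
    -- conjunctions `8` and the output gate `1`, in total `15 + 18 * β`.
    nlinarith
  · rw [hC3]
    simp only [sum_ite_two_pow_eq_ofBits]
    rw [← Matrix.trace_submatrix_pow _ ψ]
    exact Iff.rfl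

end FastMatMul

theorem mainTheorem3 {T r : ℕ} (hT : 2 ≤ T) (hr : T ^ 2 < r) (F : FastMatMul T r) :
    0 ≤ F.gamma ∧ F.gamma < 1 ∧
    ∃ c : ℝ, 0 < c ∧
      -- the trace of the third power, for entries of at most `κ log N` bits, `N = T ^ l`
      (∀ κ : ℝ, ∃ (K : ℝ) (m : ℕ), ∀ l d b : ℕ, 1 ≤ l → 1 ≤ d →
        (b : ℝ) ≤ κ * Real.logb 2 ((T : ℝ) ^ l) → ∀ τ : ℤ,
        ∃ C : ThresholdCircuit (MatrixBits (T ^ l) b),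
          C.depth ≤ 2 * d + 5 ∧
          (C.size : ℝ) ≤ K * Real.logb 2 ((T : ℝ) ^ l) ^ m *
            ((d : ℝ) * ((T : ℝ) ^ l) ^ (F.omega + c * F.gamma ^ d)) ∧
          ∀ x : MatrixBits (T ^ l) b → Bool,
            C.eval x = true ↔ τ ≤ Matrix.trace (decodeMatrix x ^ 3)) ∧
      -- counting the triangles of a graph given by the bits of its adjacency matrix
      (∃ (K : ℝ) (m : ℕ), ∀ l d : ℕ, 1 ≤ l → 1 ≤ d → ∀ τ : ℤ,
        ∃ C : ThresholdCircuit (Fin (T ^ l) × Fin (T ^ l)),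
          C.depth ≤ 2 * d + 5 ∧
          (C.size : ℝ) ≤ K * Real.logb 2 ((T : ℝ) ^ l) ^ m *
            ((d : ℝ) * ((T : ℝ) ^ l) ^ (F.omega + c * F.gamma ^ d)) ∧
          ∀ (G : SimpleGraph (Fin (T ^ l))) [DecidableRel G.Adj],
            C.eval (fun p => decide (G.Adj p.1 p.2)) = true ↔
              τ ≤ ((G.cliqueFinset 3).card : ℤ)) := by
  have hT1 : (1 : ℝ) < T := by exact_mod_cast (by omega : 1 < T)
  have hβ := F.one_lt_beta hT hr
  have hlog : ∀ l : ℕ, 1 ≤ l → 1 ≤ Real.logb 2 ((T : ℝ) ^ l) ∧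
      (l : ℝ) ≤ Real.logb 2 ((T : ℝ) ^ l) := by
    intro l hl
    have h2 : 1 ≤ Real.logb 2 (T : ℝ) := by
      rw [Real.le_logb_iff_rpow_le (by norm_num) (by linarith), Real.rpow_one]
      exact_mod_cast hT
    have hl' : (1 : ℝ) ≤ l := by exact_mod_cast hl
    rw [Real.logb_pow]
    constructor <;> nlinarith
  -- Both `l` and `1` are at most `log₂ N`, so the number of digits is at most `(κ + 2 * T + 1) *
  -- log₂ N`.
  have hW : ∀ (κ : ℝ) (l d b : ℕ), 1 ≤ l → (b : ℝ) ≤ κ * Real.logb 2 ((T : ℝ) ^ l) →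
      (15 + 18 * F.beta) * ((b + 2 * T * l + 1 : ℕ) : ℝ) ^ 3 *
        ((d : ℝ) * ((T : ℝ) ^ l) ^ (F.omega + Real.logb T F.beta * F.gamma ^ d)) ≤
      (15 + 18 * F.beta) * (κ + 2 * T + 1) ^ 3 * Real.logb 2 ((T : ℝ) ^ l) ^ 3 *
        ((d : ℝ) * ((T : ℝ) ^ l) ^ (F.omega + Real.logb T F.beta * F.gamma ^ d)) := by
    intro κ l d b hl hb
    obtain ⟨h1, h2⟩ := hlog l hl
    rw [mul_assoc (15 + 18 * F.beta) ((κ + 2 * T + 1) ^ 3), ← mul_pow]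
    gcongr
    push_cast
    nlinarith
  refine ⟨F.gamma_nonneg hT hr, F.gamma_lt_one hT hr, Real.logb T F.beta,
    Real.logb_pos hT1 hβ, ?_, ?_⟩
  · intro κ
    refine ⟨(15 + 18 * F.beta) * (κ + 2 * T + 1) ^ 3, 3, fun l d b hl hd hb τ => ?_⟩
    obtain ⟨C, hC1, hC2, hC3⟩ := F.exists_trace_circuit_of_bits hT hr hd
      (fun i j σ k => some ((i, j, σ, k) : MatrixBits (T ^ l) b)) τ
    exact ⟨C, by omega, hC2.trans (hW κ l d b hl hb), hC3⟩
  · refine ⟨(15 + 18 * F.beta) * (1 + 2 * T + 1) ^ 3, 3, fun l d hl hd τ => ?_⟩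
    -- Adjacency bits are one-bit nonnegative parts and the other parts are constantly `false`. The
    -- threshold is `6 * τ` since each triangle contributes six to the trace.
    obtain ⟨C, hC1, hC2, hC3⟩ := F.exists_trace_circuit_of_bits (b := 1) hT hr hd
      (fun i j σ _ => if σ = true then some ((i, j) : Fin (T ^ l) × Fin (T ^ l)) else none) (6 * τ)
    refine ⟨C, by omega, hC2.trans (hW 1 l d 1 hl (by simpa using (hlog l hl).1)), ?_⟩
    intro G _
    have hA : (Matrix.of fun i j : Fin (T ^ l) =>
        (∑ k : Fin 1, if (if true = true then some (i, j) else none).elim false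
          (fun p => decide (G.Adj p.1 p.2)) = true then (2 : ℤ) ^ (k : ℕ) else 0) -
        (∑ k : Fin 1, if (if false = true then some (i, j) else none).elim false
          (fun p => decide (G.Adj p.1 p.2)) = true then (2 : ℤ) ^ (k : ℕ) else 0))
        = G.adjMatrix ℤ := by
      ext i j
      simp [SimpleGraph.adjMatrix_apply]
    rw [hC3, hA, G.trace_adjMatrix_pow_three]
    omega
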